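/- Let $D$ be an oriented link diagram of a link $L$ such that every component of $L$ passes at least once over and at least once under at crossings, and let $\rho$ be a boundary-parabolic representation of the link group (given by the Wirtinger presentation of $D$) in $\mathrm{PSL}(2,\mathbb{C})$. Identify the parabolic elements of $\mathrm{PSL}(2,\mathbb{C})$ with $\mathcal P=(\mathbb{C}^2\setminus\{0\})/\pm$ by $\binom{\alpha}{\beta}\leftrightarrow\begin{pmatrix}1+\alpha\beta&-\alpha^2\\ \beta^2&1-\alpha\beta\end{pmatrix}$, let $h:\mathcal P\to\mathbb{CP}^1$ be $\binom{\alpha}{\beta}\mapsto\alpha/\beta$, and color every arc by the image under $\rho$ of its meridian. A crossing with over-arc color $a_k$ and under-arc color $a_l$ is called degenerate if $h(a_k)=h(a_l)$. Give every side $k$ of $D$ (segment between adjacent crossings) a variable $z_k$. At a crossing $j$ let $e,f,g,h$ be the sides in counterclockwise order, $e$ being the outgoing side of the over-strand, so that $e,g$ lie on the over-strand and $f,h$ on the under-strand. The potential function is $V=\sum_jV_j$, where $$V_j=\mathrm{Li}_2\Big(\frac{z_f}{z_e}\Big)-\mathrm{Li}_2\Big(\frac{z_f}{z_g}\Big)+\mathrm{Li}_2\Big(\frac{z_h}{z_g}\Big)-\mathrm{Li}_2\Big(\frac{z_h}{z_e}\Big)$$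 for a non-degenerate crossing, and, with additional variables $w_e^j,w_f^j,w_g^j$ and $w_h^j:=w_e^jw_g^j/w_f^j$, $$V_j=-\log w_e^j\log z_e+\log w_f^j\log z_f-\log w_g^j\log z_g+\log w_h^j\log z_h$$ for a degenerate crossing; if a degenerate crossing is a kink, the variables $w^j$ at the two ends of its loop are taken to be the same. Let $\mathcal H$ be the set of the equations $\exp(z_k\,\partial V/\partial z_k)=1$ for all sides $k$ and $\exp(w\,\partial V/\partial w)=1$ for all variables $w=w^j_\bullet$ of the degenerate crossings $j$. At each crossing $j$ place an octahedron with horizontal vertices $\mathrm A_j,\mathrm B_j,\mathrm C_j,\mathrm D_j$ next to the sides $e,f,g,h$, with pole $\mathrm F_j$ on the over-strand and pole $\mathrm E_j$ on the under-strand. Subdivide it into four tetrahedra by the edge $\mathrm E_j\mathrm F_j$ if $j$ is non-degenerate and by the edge $\mathrm A_j\mathrm C_j$ if $j$ is degenerate. Along every side of $D$, glue the two faces at one end to the two faces at the other end (the faces at an end contain the horizontal vertex of this end, the pole of its strand and one of the two neighboring horizontal vertices; faces in the same region of $D$ are glued, poles to poles, vertices $\mathrm A,\mathrm C$ to vertices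 $\mathrm A,\mathrm C$ and $\mathrm B,\mathrm D$ to $\mathrm B,\mathrm D$). The result is (for connected $D$) the octahedral triangulation of $\mathbb S^3\setminus(L\cup\{\text{two points}\})$, where the poles are the ideal vertices on $L$. Let $(z,w)$ be a point with all $z_k\ne0$, with $z_e,z_f,z_g,z_h$ pairwise distinct at every non-degenerate crossing, and with $w_e^j,w_f^j,w_g^j,w_h^j\neq0$ at every degenerate crossing. Then the branches of the logarithms and dilogarithms in $V$ can be chosen near $(z,w)$, and for every choice the following holds. Suppose that the tetrahedra are assigned shape parameters in $\mathbb C\setminus\{0,1\}$ by the following rule: at a non-degenerate crossing the horizontal edges $\mathrm A_j\mathrm B_j,\mathrm B_j\mathrm C_j,\mathrm C_j\mathrm D_j,\mathrm D_j\mathrm A_j$ of the octahedron have parameters $\frac{z_f}{z_e},\frac{z_g}{z_f},\frac{z_h}{z_g},\frac{z_e}{z_h}$; at a degenerate crossing the edges $\mathrm A_j\mathrm F_j,\mathrm B_j\mathrm E_j,\mathrm C_j\mathrm F_j,\mathrm D_j\mathrm E_j$ have parameters $w_e^j,w_f^j,w_g^j,w_h^j$ and the horizontal edges have parameter $1$ (the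 parameter of an edge of an octahedron is the product of the parameters of its tetrahedra at this edge). Then $(z,w)$ satisfies $\mathcal H$ if and only if (i) the shape parameters satisfy the hyperbolicity equations of the octahedral triangulation, i.e. Thurston's gluing equations of all edges and the completeness condition (the holonomy of every closed curve in the link of an ideal vertex on $L$ has derivative $1$), and (ii) at every degenerate crossing the side variables of the adjacent sides are equal (apart from the variable of the loop of a kink, on which $V$ does not depend). In particular, $\mathcal H$ induces all hyperbolicity equations, and if no crossing is degenerate, then $\mathcal H$ is equivalent to the hyperbolicity equations. -/

import Mathlib

open scoped Classical

noncomputable section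

/-! ## Ideal triangulations, gluing equations, completeness -/

/-- An oriented ideal triangulation (without boundary) with index set `T` of tetrahedra. Each
tetrahedron has vertices `0, 1, 2, 3`, numbered compatibly with the orientation; its face `f` is the
face opposite to the vertex `f`. The face `f` of `t` is glued to a face of `adj t f`; the permutation
`glue t f` sends the vertices of the face to the vertices they are glued to, and `f` to the vertex
opposite to the image face. -/
structure IdealTriangulation (T : Type) where
  adj : T → Fin 4 → T
  glue : T → Fin 4 → Equiv.Perm (Fin 4)
  adj_adj : ∀ t f, adj (adj t f) (glue t f f) = t
  glue_glue : ∀ t f, glue (adj t f) (glue t f f) = (glue t f).symm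
  glue_odd : ∀ t f, Equiv.Perm.sign (glue t f) = -1
  no_self_glue : ∀ t f, ¬ (adj t f = t ∧ glue t f f = f)

/-- The parameter at the edge `e` of an ideal tetrahedron `(v₀, v₁, v₂, v₃)` whose cross-ratio
`[v₀, v₁, v₂, v₃] = (v₃ - v₀)(v₂ - v₁) / ((v₂ - v₀)(v₃ - v₁))` is `x`. -/
def edgeParam (x : ℂ) (e : Sym2 (Fin 4)) : ℂ :=
  if e = s(0, 1) ∨ e = s(2, 3) then x
  else if e = s(0, 3) ∨ e = s(1, 2) then 1 / (1 - x)
  else 1 - 1 / x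

namespace IdealTriangulation

variable {T : Type} (M : IdealTriangulation T)

/-- One face gluing identifies the edges of the glued faces. -/
inductive EdgeStep : T × Sym2 (Fin 4) → T × Sym2 (Fin 4) → Prop
  | step (t : T) (f : Fin 4) (e : Sym2 (Fin 4)) (hf : f ∉ e) :
      EdgeStep (t, e) (M.adj t f, e.map (M.glue t f))

/-- Two edges of tetrahedra become the same edge of the triangulation. -/
def SameEdge : T × Sym2 (Fin 4) → T × Sym2 (Fin 4) → Prop :=
  Relation.EqvGen M.EdgeStep

/-- Thurston's gluing equations: around every edge of the triangulation, the parameters of the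
tetrahedra meeting at this edge have product `1`. -/
def EdgeEquations [Fintype T] (x : T → ℂ) : Prop :=
  ∀ a : T × Sym2 (Fin 4), ¬ a.2.IsDiag →
    ∏ b : T × Sym2 (Fin 4),
      (if ¬ b.2.IsDiag ∧ M.SameEdge a b then edgeParam (x b.1) b.2 else 1) = 1

/-- Normal paths in the triangulated link of an ideal vertex, with the derivative of their
holonomy. A state `(t, v, f)` stands for the triangle cut off from `t` at the vertex `v`, entered
through its side in the face `f`. One step of the path, given by `π`, enters the triangle at
`π 0` of `t` through the face `π 2` and leaves it through the face `π 3`, so it turns around the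
corner on the edge `π 0 π 1`; the derivative is multiplied by the parameter of this edge or by its
inverse, according to the direction of the turn. -/
inductive NormalPath (x : T → ℂ) : T × Fin 4 × Fin 4 → T × Fin 4 × Fin 4 → ℂ → Prop
  | nil (a : T × Fin 4 × Fin 4) : NormalPath x a a 1
  | cons (t : T) (π : Equiv.Perm (Fin 4)) (b : T × Fin 4 × Fin 4) (c : ℂ)
      (h : NormalPath x (M.adj t (π 3), M.glue t (π 3) (π 0), M.glue t (π 3) (π 3)) b c) :
      NormalPath x (t, π 0, π 2) b
        (edgeParam (x t) s(π 0, π 1) ^ ((Equiv.Perm.sign π : ℤˣ) : ℤ) * c)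

/-- Completeness at the ideal vertices in `K`: the holonomy of every closed curve in the link of
such a vertex has derivative `1`. -/
def IsComplete (x : T → ℂ) (K : T → Fin 4 → Prop) : Prop :=
  ∀ t v f c, K t v → M.NormalPath x (t, v, f) (t, v, f) c → c = 1

end IdealTriangulation

/-! ## Oriented link diagrams -/

/-- Whether the end `δ = (j, i)` of a side at the crossing `j` is outgoing, i.e. the strand leaves
the crossing there. The four ends at a crossing are numbered counterclockwise; `0` is the outgoing
end of the over-strand, `2` is its incoming end, and `1`, `3` are the ends of the under-strand,
which runs from `3` to `1` at a positive crossing and from `1` to `3` at a negative one. -/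
def dartOut {J : Type} (positive : J → Bool) (δ : J × Fin 4) : Bool :=
  ![true, positive δ.1, false, !(positive δ.1)] δ.2

/-- An oriented link diagram on the sphere, as a combinatorial map. `Crossing × Fin 4` is the set of
ends of sides at crossings ("darts"), with the cyclic order and over/under information of `dartOut`;
`across` exchanges the two ends of a side. The Euler characteristic condition says that every
connected component of the map is spherical. -/
structure LinkDiagram where
  Crossing : Type
  [fintypeCrossing : Fintype Crossing]
  positive : Crossing → Bool
  across : Crossing × Fin 4 → Crossing × Fin 4
  across_across : ∀ δ, across (across δ) = δ
  out_across : ∀ δ, dartOut positive (across δ) = !(dartOut positive δ)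
  planar :
    Nat.card (Quot fun δ ε : Crossing × Fin 4 => ε = ((across δ).1, (across δ).2 + 1)) =
      Nat.card Crossing +
        2 * Nat.card (Quot fun j k : Crossing => ∃ i, (across (j, i)).1 = k)

attribute [instance] LinkDiagram.fintypeCrossing

namespace LinkDiagram

variable (D : LinkDiagram)

/-- Ends of sides at crossings. -/
abbrev Dart : Type := D.Crossing × Fin 4

/-- Walk along the side that starts at the end `δ`, then straight through the crossing reached. -/
def straight (δ : D.Dart) : D.Dart := ((D.across δ).1, (D.across δ).2 + 2)

/-- Every link component passes at least once over and at least once under (at crossings). -/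
def EveryComponentOverAndUnder : Prop :=
  ∀ δ : D.Dart, (∃ n : ℕ, (D.straight^[n] δ).2 = 0 ∨ (D.straight^[n] δ).2 = 2) ∧
    (∃ n : ℕ, (D.straight^[n] δ).2 = 1 ∨ (D.straight^[n] δ).2 = 3)

/-- The sides of the diagram; a side is represented by its initial end. -/
def Side : Type := {δ : D.Dart // dartOut D.positive δ = true}

instance : Fintype D.Side := inferInstanceAs (Fintype {δ : D.Dart // dartOut D.positive δ = true})

/-- The side that a dart belongs to. -/
def side (δ : D.Dart) : D.Side :=
  if h : dartOut D.positive δ = true then ⟨δ, h⟩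
  else ⟨D.across δ, by rw [D.out_across]; simpa using h⟩

/-- Both ends of the side at `δ` are at the same crossing. -/
def IsLoop (δ : D.Dart) : Prop := (D.across δ).1 = δ.1

/-! ### The link group and its parabolic representations -/

/-- The arcs of the diagram: sides, joined when they are consecutive on an over-strand. -/
inductive ArcStep : D.Dart → D.Dart → Prop
  | side (δ : D.Dart) : ArcStep δ (D.across δ)
  | over (j : D.Crossing) : ArcStep (j, 0) (j, 2)

def Arc : Type := Quot D.ArcStep

def arc (δ : D.Dart) : D.Arc := Quot.mk _ δ

/-- Wirtinger relations: with `k` the over-arc and `l`, `m` the under-arcs at the ends `3`, `1` of a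
crossing, `m = k l k⁻¹`. -/
def wirtingerRelations : Set (FreeGroup D.Arc) :=
  Set.range fun j : D.Crossing =>
    FreeGroup.of (D.arc (j, 1)) *
      (FreeGroup.of (D.arc (j, 0)) * FreeGroup.of (D.arc (j, 3)) *
        (FreeGroup.of (D.arc (j, 0)))⁻¹)⁻¹

/-- The link group, by the Wirtinger presentation. -/
abbrev LinkGroup : Type := PresentedGroup D.wirtingerRelations

end LinkDiagram

/-- `PSL(2, ℂ)`. -/
abbrev PSL2C : Type := Matrix.ProjectiveSpecialLinearGroup (Fin 2) ℂ

/-- Nonzero vectors of `ℂ²`. -/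
abbrev NonzeroVec : Type := {v : Fin 2 → ℂ // v ≠ 0}

/-- Equality up to sign. -/
def signSetoid : Setoid NonzeroVec where
  r v u := v.1 = u.1 ∨ v.1 = -u.1
  iseqv := by
    refine ⟨fun v => Or.inl rfl, ?_, ?_⟩
    · rintro v u (h | h)
      · exact Or.inl h.symm
      · exact Or.inr (by rw [h, neg_neg])
    · rintro v u t (h | h) (h' | h')
      · exact Or.inl (h.trans h')
      · exact Or.inr (h.trans h')
      · exact Or.inr (by rw [h, h'])
      · exact Or.inl (by rw [h, h', neg_neg])

/-- The parabolic quandle `𝒫 = (ℂ² ∖ {0}) / ±`. -/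
def ParabolicQuandle : Type := Quotient signSetoid

/-- The matrix of the parabolic element that belongs to the vector `(α, β)`. -/
def parabolicMatrix (v : Fin 2 → ℂ) : Matrix.SpecialLinearGroup (Fin 2) ℂ :=
  ⟨!![1 + v 0 * v 1, -(v 0) ^ 2; (v 1) ^ 2, 1 - v 0 * v 1], by
    rw [Matrix.det_fin_two_of]; ring⟩

namespace ParabolicQuandle

/-- The identification of `𝒫` with the set of parabolic elements of `PSL(2, ℂ)`. -/
def toPSL : ParabolicQuandle → PSL2C :=
  Quotient.lift (s := signSetoid) (fun v => (QuotientGroup.mk (parabolicMatrix v.1) : PSL2C)) (by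
    rintro v u (h | h)
    · simp only [h]
    · have : parabolicMatrix v.1 = parabolicMatrix u.1 := by
        apply Subtype.ext
        simp [parabolicMatrix, h]
      simp only [this])

/-- The Hopf map `𝒫 → ℂP¹`, `(α, β) ↦ α / β`. -/
def hopf : ParabolicQuandle → Projectivization ℂ (Fin 2 → ℂ) :=
  Quotient.lift (s := signSetoid) (fun v => Projectivization.mk ℂ v.1 v.2) (by
    rintro v u (h | h)
    · simp only [h]
    · refine (Projectivization.mk_eq_mk_iff' ℂ v.1 u.1 v.2 u.2).2 ⟨-1, ?_⟩
      rw [h, neg_one_smul])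

end ParabolicQuandle

namespace LinkDiagram

variable (D : LinkDiagram)

/-- `a` is the arc-coloring induced by `ρ`: the generator of each arc goes to the parabolic element
`a` of this arc. Such an `a` exists exactly when `ρ` sends every meridian to a nontrivial parabolic
element, which is the condition that `ρ` is boundary-parabolic (the other peripheral elements
commute with a meridian); it is then unique. -/
def IsInducedColoring (ρ : D.LinkGroup →* PSL2C) (a : D.Arc → ParabolicQuandle) : Prop :=
  ∀ α : D.Arc, (a α).toPSL = ρ (PresentedGroup.of α)

/-- A crossing is degenerate when the colors of its over-arc and its under-arc have the same image
under the Hopf map. -/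
def degenerate (a : D.Arc → ParabolicQuandle) : Set D.Crossing :=
  {j | (a (D.arc (j, 3))).hopf = (a (D.arc (j, 0))).hopf}

end LinkDiagram

/-! ## The octahedral triangulation -/

/-- Vertices of the octahedron at a crossing. `A, B, C, D` lie (counterclockwise) next to the ends
`0, 1, 2, 3` of the crossing, `F` is on the upper strand and `E` on the lower one. -/
inductive OctVertex | A | B | C | D | E | F
  deriving DecidableEq

namespace Octahedron

open OctVertex

/-- The horizontal vertex at the end `i`. -/
def ring : Fin 4 → OctVertex := ![A, B, C, D]

/-- The pole on the strand of the end `i`. -/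
def pole : Fin 4 → OctVertex := ![F, E, F, E]

/-- The vertices of the `t`-th tetrahedron of the octahedron, in an order that matches the
orientation. The octahedron is subdivided by the edge `EF` if `s = false`, by `AC` if `s = true`. -/
def vert (s : Bool) : Fin 4 → Fin 4 → OctVertex :=
  match s with
  | false => fun t => ![E, F, ring t, ring (t + 1)]
  | true => ![![E, B, C, A], ![E, D, A, C], ![F, B, A, C], ![F, D, C, A]]

/-- Every end `i` of the crossing has two faces of the octahedron attached to it: the face
`(i, true)` with vertices `ring i`, `ring (i + 1)`, `pole i` on its counterclockwise side and the
face `(i, false)` with vertices `ring i`, `ring (i - 1)`, `pole i` on its clockwise side. This is the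
tetrahedron that contains the face. -/
def outerTet (s : Bool) (i : Fin 4) (b : Bool) : Fin 4 :=
  match s, b with
  | false, true => i
  | false, false => i + 3
  | true, true => ![2, 0, 3, 1] i
  | true, false => ![3, 0, 2, 1] i

/-- The permutation of `Fin 4` with values `f` and inverse `g`. -/
def mkPerm (f g : Fin 4 → Fin 4) (h₁ : ∀ i, g (f i) = i) (h₂ : ∀ i, f (g i) = i) :
    Equiv.Perm (Fin 4) := ⟨f, g, h₁, h₂⟩

/-- For the face `(i, b)` of the octahedron, the numbers in the tetrahedron containing it of, in this
order: its vertex in `{A, C}`, its vertex in `{B, D}`, its pole, and the vertex opposite to it. -/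
def outerLabel (s : Bool) (i : Fin 4) (b : Bool) : Equiv.Perm (Fin 4) :=
  match s, b with
  | true, true => mkPerm ![2, 1, 0, 3] ![2, 1, 0, 3] (by decide) (by decide)
  | true, false => mkPerm ![3, 1, 0, 2] ![2, 1, 3, 0] (by decide) (by decide)
  | false, true =>
      ![mkPerm ![2, 3, 1, 0] ![3, 2, 0, 1] (by decide) (by decide),
        mkPerm ![3, 2, 0, 1] ![2, 3, 1, 0] (by decide) (by decide),
        mkPerm ![2, 3, 1, 0] ![3, 2, 0, 1] (by decide) (by decide),
        mkPerm ![3, 2, 0, 1] ![2, 3, 1, 0] (by decide) (by decide)] i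
  | false, false =>
      ![mkPerm ![3, 2, 1, 0] ![3, 2, 1, 0] (by decide) (by decide),
        mkPerm ![2, 3, 0, 1] ![2, 3, 0, 1] (by decide) (by decide),
        mkPerm ![3, 2, 1, 0] ![3, 2, 1, 0] (by decide) (by decide),
        mkPerm ![2, 3, 0, 1] ![2, 3, 0, 1] (by decide) (by decide)] i

/-- The face `f` of the `t`-th tetrahedron is either glued inside the octahedron, to a face of the
tetrahedron `inl t'`, or it is the face `inr (i, b)` of the octahedron. -/
def faceKind (s : Bool) (t f : Fin 4) : Fin 4 ⊕ Fin 4 × Bool :=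
  match s with
  | false =>
      ![if t = 0 ∨ t = 2 then .inr (t, true) else .inr (t + 1, false),
        if t = 1 ∨ t = 3 then .inr (t, true) else .inr (t + 1, false),
        .inl (t + 1), .inl (t + 3)] f
  | true =>
      ![.inl (![2, 3, 0, 1] t), .inl (![1, 0, 3, 2] t),
        .inr (![1, 3, 2, 0] t, false), .inr (![1, 3, 0, 2] t, true)] f

/-- The tables match the names of the vertices. -/
theorem outer_names (s : Bool) (i : Fin 4) (b : Bool) :
    ({vert s (outerTet s i b) (outerLabel s i b 0), vert s (outerTet s i b) (outerLabel s i b 1)} :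
        Finset OctVertex) = {ring i, ring (if b then i + 1 else i + 3)} ∧
      (vert s (outerTet s i b) (outerLabel s i b 0) = A ∨
        vert s (outerTet s i b) (outerLabel s i b 0) = C) ∧
      vert s (outerTet s i b) (outerLabel s i b 2) = pole i := by
  revert s i b; decide

/-- Inner gluings are by the transposition `(2 3)`; they identify vertices of the same name. -/
theorem inner_names (s : Bool) (t f t' : Fin 4) (h : faceKind s t f = .inl t') :
    ∀ v, v ≠ f → vert s t v = vert s t' (Equiv.swap 2 3 v) := by
  revert s t f t' h; decide

theorem faceKind_outer (s : Bool) (i : Fin 4) (b : Bool) :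
    faceKind s (outerTet s i b) (outerLabel s i b 3) = .inr (i, b) := by
  revert s i b; decide

theorem outer_of_faceKind (s : Bool) (t f i : Fin 4) (b : Bool)
    (h : faceKind s t f = .inr (i, b)) :
    outerTet s i b = t ∧ outerLabel s i b 3 = f := by
  revert s t f i b h; decide

theorem faceKind_inner (s : Bool) (t f t' : Fin 4) (h : faceKind s t f = .inl t') :
    faceKind s t' (Equiv.swap 2 3 f) = .inl t ∧ t' ≠ t := by
  revert s t f t' h; decide

theorem sign_outerLabel (s : Bool) (i : Fin 4) (b : Bool) :
    Equiv.Perm.sign (outerLabel s i b) = if b then -1 else 1 := by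
  revert s i b; decide

end Octahedron

namespace LinkDiagram

open Octahedron

variable (D : LinkDiagram)

/-- The octahedral triangulation: the octahedron at the crossing `j` is subdivided into the four
tetrahedra `(j, 0), …, (j, 3)` by the edge `AC` if `s j = true` and by the edge `EF` otherwise. The
octahedra are glued along the sides of the diagram: the face on the counterclockwise (clockwise) side
of a dart `δ` is glued to the face on the clockwise (counterclockwise) side of the other end
`across δ` of the side, such that poles go to poles, `{A, C}` to `{A, C}` and `{B, D}` to
`{B, D}`. -/
def octahedral (s : D.Crossing → Bool) : IdealTriangulation (D.Crossing × Fin 4) where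
  adj t f :=
    match faceKind (s t.1) t.2 f with
    | .inl t' => (t.1, t')
    | .inr (i, b) =>
        ((D.across (t.1, i)).1,
          outerTet (s (D.across (t.1, i)).1) (D.across (t.1, i)).2 (!b))
  glue t f :=
    match faceKind (s t.1) t.2 f with
    | .inl _ => Equiv.swap 2 3
    | .inr (i, b) =>
        (outerLabel (s t.1) i b).symm.trans
          (outerLabel (s (D.across (t.1, i)).1) (D.across (t.1, i)).2 (!b))
  adj_adj t f := by
    obtain ⟨j, t⟩ := t
    rcases h : faceKind (s j) t f with t' | ⟨i, b⟩
    · have h' := (faceKind_inner _ _ _ _ h).1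
      simp only [h, h']
    · obtain ⟨h1, h2⟩ := outer_of_faceKind _ _ _ _ _ h
      have h3 : (outerLabel (s j) i b).symm f = 3 := by
        rw [← h2, Equiv.symm_apply_apply]
      simp only [h, Equiv.trans_apply, h3, faceKind_outer, Prod.mk.eta, D.across_across,
        Bool.not_not, h1]
  glue_glue t f := by
    obtain ⟨j, t⟩ := t
    rcases h : faceKind (s j) t f with t' | ⟨i, b⟩
    · have h' := (faceKind_inner _ _ _ _ h).1
      simp only [h, h', Equiv.symm_swap]
    · obtain ⟨h1, h2⟩ := outer_of_faceKind _ _ _ _ _ h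
      have h3 : (outerLabel (s j) i b).symm f = 3 := by
        rw [← h2, Equiv.symm_apply_apply]
      simp only [h, Equiv.trans_apply, h3, faceKind_outer, Prod.mk.eta, D.across_across,
        Bool.not_not, Equiv.symm_trans_apply, Equiv.symm_symm]
      rfl
  glue_odd t f := by
    obtain ⟨j, t⟩ := t
    rcases h : faceKind (s j) t f with t' | ⟨i, b⟩
    · simp only [h]
      exact Equiv.Perm.sign_swap (by decide)
    · simp only [h, Equiv.Perm.sign_trans, Equiv.Perm.sign_symm, sign_outerLabel]
      cases b <;> simp
  no_self_glue t f := by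
    obtain ⟨j, t⟩ := t
    rcases h : faceKind (s j) t f with t' | ⟨i, b⟩
    · have h' := (faceKind_inner _ _ _ _ h).2
      simp only [h]
      rintro ⟨h1, -⟩
      exact h' (congrArg Prod.snd h1)
    · simp only [h]
      rintro ⟨h1, h2⟩
      have h4 := faceKind_outer (s (D.across (j, i)).1) (D.across (j, i)).2 (!b)
      obtain ⟨h5, h6⟩ := outer_of_faceKind _ _ _ _ _ h
      have h3 : (outerLabel (s j) i b).symm f = 3 := by
        rw [← h6, Equiv.symm_apply_apply]
      rw [Equiv.trans_apply, h3] at h2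
      have h7 : (D.across (j, i)).1 = j := congrArg Prod.fst h1
      have h8 := congrArg Prod.snd h1
      simp only at h8
      rw [h2, h8, h7, h] at h4
      simp at h4

/-- The vertices of tetrahedra that are poles of octahedra: the ideal vertices on the link. The
other vertices of the triangulation are the two additional points `±∞`. -/
def IsLinkVertex (s : D.Crossing → Bool) (t : D.Crossing × Fin 4) (v : Fin 4) : Prop :=
  vert (s t.1) t.2 v = .E ∨ vert (s t.1) t.2 v = .F

/-- The parameter at the edge `uv` of the octahedron at the crossing `j`: the product of the
parameters of its tetrahedra with this edge. -/
def octParam (s : D.Crossing → Bool) (x : D.Crossing × Fin 4 → ℂ) (j : D.Crossing)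
    (u v : OctVertex) : ℂ :=
  ∏ t : Fin 4, ∏ k : Fin 4, ∏ l : Fin 4,
    if vert (s j) t k = u ∧ vert (s j) t l = v then edgeParam (x (j, t)) s(k, l) else 1

/-- The subdivision of the octahedra determined by the set `G` of degenerate crossings. -/
def subdivision (G : Set D.Crossing) (j : D.Crossing) : Bool := decide (j ∈ G)

/-! ## The potential function -/

/-- The side variable at the end `i` of the crossing `j`
(`z_e, z_f, z_g, z_h` for `i = 0, 1, 2, 3`). -/
def zAt (z : D.Side → ℂ) (j : D.Crossing) (i : Fin 4) : ℂ := z (D.side (j, i))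

/-- The values `w_e, w_f, w_g, w_h` at the ends `0, 1, 2, 3` of the crossing `j`, where
`w_h = w_e w_g / w_f`. At a kink, the variables `w` at the two ends of its loop are the same, i.e.
`w_f = w_g` if the loop joins the ends `1, 2` (or if it joins `3, 0`, since this means
`w_h = w_e`), and `w_e = w_f` if the loop joins `0, 1` (or `2, 3`); then `w j 2`, or
`w j 0`, is not used. -/
def wAt (w : D.Crossing → Fin 3 → ℂ) (j : D.Crossing) : Fin 4 → ℂ :=
  let we := if D.across (j, 0) = (j, 1) ∨ D.across (j, 2) = (j, 3) then w j 1 else w j 0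
  let wf := w j 1
  let wg := if D.across (j, 1) = (j, 2) ∨ D.across (j, 3) = (j, 0) then w j 1 else w j 2
  ![we, wf, wg, we * wg / wf]

/-- `ℓ` is a holomorphic branch of the logarithm near `u`. -/
def _root_.IsLogBranch (ℓ : ℂ → ℂ) (u : ℂ) : Prop :=
  ∀ᶠ x in nhds u, DifferentiableAt ℂ ℓ x ∧ Complex.exp (ℓ x) = x

/-- `L` is a branch near `u` of the dilogarithm `Li₂(u) = -∫₀ᵘ log(1 - t)/t dt`, where the integral is
along a path `γ` from `0` to `u` in `ℂ ∖ {0, 1}`, on which the logarithm `μ` of `1 - γ` is continued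
from `log 1 = 0`; near `u`, the continued logarithm is `m`. -/
def _root_.IsDilogBranch (L : ℂ → ℂ) (u : ℂ) : Prop :=
  ∃ (γ μ : ℝ → ℂ) (m : ℂ → ℂ),
    ContDiff ℝ 1 γ ∧ γ 0 = 0 ∧ γ 1 = u ∧ (∀ t ∈ Set.Ioc (0 : ℝ) 1, γ t ≠ 0) ∧
    ContinuousOn μ (Set.Icc 0 1) ∧ μ 0 = 0 ∧
    (∀ t ∈ Set.Icc (0 : ℝ) 1, Complex.exp (μ t) = 1 - γ t) ∧
    (∀ᶠ x in nhds u, DifferentiableAt ℂ m x ∧ Complex.exp (m x) = 1 - x) ∧ m u = μ 1 ∧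
    L u = -∫ t in (0 : ℝ)..1, μ t / γ t * deriv γ t ∧
    ∀ᶠ x in nhds u, HasDerivAt L (-(m x) / x) x

/-- The arguments of the four dilogarithms at a non-degenerate crossing. -/
def dilogArg (z : D.Side → ℂ) (j : D.Crossing) : Fin 4 → ℂ :=
  ![D.zAt z j 1 / D.zAt z j 0, D.zAt z j 1 / D.zAt z j 2,
    D.zAt z j 3 / D.zAt z j 2, D.zAt z j 3 / D.zAt z j 0]

/-- A choice, near the point `(z, w)`, of branches of all the logarithms and dilogarithms in the
potential function; `G` is the set of degenerate crossings. -/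
structure Branches (G : Set D.Crossing) (z : D.Side → ℂ) (w : D.Crossing → Fin 3 → ℂ) where
  li : D.Crossing → Fin 4 → ℂ → ℂ
  logz : D.Crossing → Fin 4 → ℂ → ℂ
  logw : D.Crossing → Fin 4 → ℂ → ℂ
  li_branch : ∀ j ∉ G, ∀ i, IsDilogBranch (li j i) (D.dilogArg z j i)
  logz_branch : ∀ j ∈ G, ∀ i, IsLogBranch (logz j i) (D.zAt z j i)
  logw_branch : ∀ j ∈ G, ∀ i, IsLogBranch (logw j i) (D.wAt w j i)

variable {D} in
/-- The potential function `V = ∑ⱼ Vⱼ` (with the chosen branches). -/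
def Branches.V {G : Set D.Crossing} {z₀ : D.Side → ℂ} {w₀ : D.Crossing → Fin 3 → ℂ}
    (b : D.Branches G z₀ w₀) (z : D.Side → ℂ) (w : D.Crossing → Fin 3 → ℂ) : ℂ :=
  ∑ j : D.Crossing,
    if j ∈ G then
      -(b.logw j 0 (D.wAt w j 0) * b.logz j 0 (D.zAt z j 0))
        + b.logw j 1 (D.wAt w j 1) * b.logz j 1 (D.zAt z j 1)
        - b.logw j 2 (D.wAt w j 2) * b.logz j 2 (D.zAt z j 2)
        + b.logw j 3 (D.wAt w j 3) * b.logz j 3 (D.zAt z j 3)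
    else
      b.li j 0 (D.dilogArg z j 0) - b.li j 1 (D.dilogArg z j 1)
        + b.li j 2 (D.dilogArg z j 2) - b.li j 3 (D.dilogArg z j 3)

/-- The equations `exp(z_k ∂V/∂z_k) = 1` for all sides `k` at the point `(z, w)`. -/
def ZEquations (V : (D.Side → ℂ) → (D.Crossing → Fin 3 → ℂ) → ℂ)
    (z : D.Side → ℂ) (w : D.Crossing → Fin 3 → ℂ) : Prop :=
  ∀ k : D.Side,
    Complex.exp (z k * deriv (fun t : ℂ => V (Function.update z k t) w) (z k)) = 1

/-- The equations `exp(w ∂V/∂w) = 1` for the variables `w` of the degenerate crossings at the point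
`(z, w)`. (For a variable that is not used, the equation is trivial.) -/
def WEquations (G : Set D.Crossing) (V : (D.Side → ℂ) → (D.Crossing → Fin 3 → ℂ) → ℂ)
    (z : D.Side → ℂ) (w : D.Crossing → Fin 3 → ℂ) : Prop :=
  ∀ j ∈ G, ∀ i : Fin 3,
    Complex.exp (w j i * deriv
      (fun t : ℂ => V z (Function.update w j (Function.update (w j) i t))) (w j i)) = 1

/-- The domain of the variables. -/
def Admissible (G : Set D.Crossing) (z : D.Side → ℂ) (w : D.Crossing → Fin 3 → ℂ) : Prop :=
  (∀ k, z k ≠ 0) ∧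
  (∀ j ∉ G, ∀ i i' : Fin 4, i ≠ i' → D.zAt z j i ≠ D.zAt z j i') ∧
  (∀ j ∈ G, ∀ i, D.wAt w j i ≠ 0)

/-- `x` assigns nondegenerate shapes to the tetrahedra according to `(z, w)`. At a non-degenerate
crossing, the horizontal edges `AB, BC, CD, DA` of the octahedron have the parameters
`z_f/z_e, z_g/z_f, z_h/z_g, z_e/z_h`. At a degenerate crossing, the edges `AF, BE, CF, DE` have the
parameters `w_e, w_f, w_g, w_h`, and the horizontal edges have the parameter `1`. -/
structure IsShapeAssignment (G : Set D.Crossing) (z : D.Side → ℂ)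
    (w : D.Crossing → Fin 3 → ℂ) (x : D.Crossing × Fin 4 → ℂ) : Prop where
  ne_zero : ∀ t, x t ≠ 0
  ne_one : ∀ t, x t ≠ 1
  horizontal : ∀ j ∉ G, ∀ i,
    D.octParam (D.subdivision G) x j (ring i) (ring (i + 1)) = D.zAt z j (i + 1) / D.zAt z j i
  vertical_degenerate : ∀ j ∈ G, ∀ i,
    D.octParam (D.subdivision G) x j (ring i) (pole i) = D.wAt w j i
  horizontal_degenerate : ∀ j ∈ G, ∀ i,
    D.octParam (D.subdivision G) x j (ring i) (ring (i + 1)) = 1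

/-- The hyperbolicity equations of the octahedral triangulation: Thurston's gluing equations of all
edges and the completeness condition at the link. -/
def HyperbolicityEquations (G : Set D.Crossing) (x : D.Crossing × Fin 4 → ℂ) : Prop :=
  (D.octahedral (D.subdivision G)).EdgeEquations x ∧
    (D.octahedral (D.subdivision G)).IsComplete x (D.IsLinkVertex (D.subdivision G))

/-- Around every degenerate crossing, the side variables coincide (except for the loop of a kink, the
variable of which does not occur in the potential function). -/
def EqualAroundDegenerate (G : Set D.Crossing) (z : D.Side → ℂ) : Prop :=
  ∀ j ∈ G, ∀ i i' : Fin 4, ¬ D.IsLoop (j, i) → ¬ D.IsLoop (j, i') → D.zAt z j i = D.zAt z j i'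

end LinkDiagram

end

/-!
The logarithmic derivative `exp (z_k ∂V/∂z_k)` is a product of two factors `sideFactor`, one for each
end of the side `k` (`LinkDiagram.Branches.zEquations_iff`), whatever branches are chosen. The factor
at an end is the derivative of the holonomy of turning around the vertical edge of the octahedron
there (`LinkDiagram.IsShapeAssignment.turn_eq`). So the equation of `k` is completeness along the
closed path around the strand of `k`, and completeness implies all equations of the side variables.
The equations of the variables `w` at a degenerate crossing equate the adjacent side variables
(`LinkDiagram.Branches.wEquations_iff_equalAroundDegenerate`).

For the converse, the links of the ideal vertices on the link are developed explicitly. The link of a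
pole of an octahedron is a quadrilateral, at a non-degenerate crossing with corners `z_e, z_f, z_g, z_h`
for the upper pole and their inverses for the lower one. The translation of the meridian is one of its
diagonals, which is nonzero because a trivial meridian would persist along the whole component and
cannot occur at an under-passage (`LinkDiagram.sideFactor_ne_one`). Scale every quadrilateral so that
this diagonal is `±1`. Two sides of the quadrilaterals meet at each end of a side of the diagram; their
difference is the normalized translation and their quotient is the factor, so the equations of the
side variables force them to match (`LinkDiagram.positions_of_factor`). The result is a Euclidean
structure on the links without rotational or dilational holonomy, which gives completeness, including
longitudes, and the equations of all edges with an end on the link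
(`IdealTriangulation.IsDeveloped.isComplete`, `IdealTriangulation.edgeEquations_of_potential`). Around a
horizontal edge, that is, around a region of the diagram, the parameters `z_{i+1}/z_i` telescope
(`LinkDiagram.edgePotential_rotate_horizontal`); at degenerate crossings this uses that the adjacent
side variables are equal, where the variable of the loop of a kink may be changed to the common value.
-/

noncomputable section

/-! ### Edge equations and completeness from potentials -/

section

open Equiv

/-- A permutation of four letters is determined by its sign and two of its values. -/
theorem perm_eq_of_sign_eq {π ρ : Perm (Fin 4)} (hs : Perm.sign π = Perm.sign ρ)
    (h0 : π 0 = ρ 0) (h1 : π 1 = ρ 1) : π = ρ := by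
  revert π ρ; decide

theorem perm_eq_of_sign_eq' {π ρ : Perm (Fin 4)} (hs : Perm.sign π = Perm.sign ρ)
    (h0 : π 0 = ρ 0) (h2 : π 2 = ρ 2) : π = ρ := by
  revert π ρ; decide

theorem exists_even_perm {u v : Fin 4} (h : u ≠ v) :
    ∃ π : Perm (Fin 4), Perm.sign π = 1 ∧ π 0 = u ∧ π 1 = v := by
  revert u v; decide

namespace IdealTriangulation

variable {T : Type} (M : IdealTriangulation T)

/-- Rotation about an edge. The pair `(t, π)` stands for the edge of `t` directed from `π 0` to `π 1`,
together with the rotation that enters `t` through the face `π 2` and leaves it through the face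
`π 3`; since gluings are odd, the sign of `π` does not change. For even `π` the pair is just a
directed edge of `t`. -/
def rotate (a : T × Perm (Fin 4)) : T × Perm (Fin 4) :=
  (M.adj a.1 (a.2 3), M.glue a.1 (a.2 3) * a.2 * swap 2 3)

theorem rotate_injective : Function.Injective M.rotate := by
  refine Function.LeftInverse.injective
    (g := fun a => (M.adj a.1 (a.2 2), M.glue a.1 (a.2 2) * a.2 * swap 2 3)) ?_
  rintro ⟨t, π⟩
  have h2 : (M.glue t (π 3) * π * swap 2 3 : Perm (Fin 4)) 2 = M.glue t (π 3) (π 3) := by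
    simp [Perm.mul_apply]
  simp only [rotate, h2, M.adj_adj, M.glue_glue, Prod.mk.injEq, true_and]
  ext k
  simp [Perm.mul_apply]

theorem sign_rotate (a : T × Perm (Fin 4)) : Perm.sign (M.rotate a).2 = Perm.sign a.2 := by
  simp [rotate, Perm.sign_mul, M.glue_odd]

/-- The gluing equations hold if the parameters are the quotients of a nonvanishing function `Λ`
under rotation about edges. The relation `O` directs every edge in a way compatible with the
gluings, so that an edge class corresponds to a set of directed edges permuted by `rotate`, over
which the product of these quotients telescopes. -/
theorem edgeEquations_of_potential [Fintype T] {x : T → ℂ} {O : T → Fin 4 → Fin 4 → Prop}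
    (hO : ∀ t u v, u ≠ v → (O t u v ↔ ¬ O t v u))
    (hOglue : ∀ t f u v, u ≠ f → v ≠ f → O t u v → O (M.adj t f) (M.glue t f u) (M.glue t f v))
    {Λ : T × Perm (Fin 4) → ℂ}
    (hne : ∀ a, Perm.sign a.2 = 1 → O a.1 (a.2 0) (a.2 1) → Λ a ≠ 0)
    (hΛ : ∀ a, Perm.sign a.2 = 1 → O a.1 (a.2 0) (a.2 1) →
      Λ (M.rotate a) = edgeParam (x a.1) s(a.2 0, a.2 1) * Λ a) :
    M.EdgeEquations x := by
  intro a ha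
  set S : Finset (T × Perm (Fin 4)) := Finset.univ.filter fun q =>
    Perm.sign q.2 = 1 ∧ O q.1 (q.2 0) (q.2 1) ∧ M.SameEdge a (q.1, s(q.2 0, q.2 1)) with hS
  have memS : ∀ q, q ∈ S ↔ Perm.sign q.2 = 1 ∧ O q.1 (q.2 0) (q.2 1) ∧
      M.SameEdge a (q.1, s(q.2 0, q.2 1)) := fun q => by simp [hS]
  have h1 : ∏ b : T × Sym2 (Fin 4),
      (if ¬ b.2.IsDiag ∧ M.SameEdge a b then edgeParam (x b.1) b.2 else 1) =
      ∏ q ∈ S, edgeParam (x q.1) s(q.2 0, q.2 1) := by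
    rw [← Finset.prod_filter]
    symm
    refine Finset.prod_nbij (fun q => (q.1, s(q.2 0, q.2 1))) ?_ ?_ ?_ ?_
    · intro q hq
      rw [memS] at hq
      simp only [Finset.mem_filter, Finset.mem_univ, true_and, Sym2.mk_isDiag_iff]
      exact ⟨fun h => by simpa using q.2.injective h, hq.2.2⟩
    · rintro ⟨t, π⟩ hq ⟨t', ρ⟩ hq' h
      have hq := (memS _).1 hq
      have hq' := (memS _).1 hq'
      simp only [Prod.mk.injEq, Sym2.eq_iff] at h hq hq'
      obtain ⟨rfl, ⟨e0, e1⟩ | ⟨e0, e1⟩⟩ := h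
      · rw [perm_eq_of_sign_eq (hq.1.trans hq'.1.symm) e0 e1]
      · exfalso
        have h01 : π 0 ≠ π 1 := fun h => by simpa using π.injective h
        refine (hO t _ _ h01).1 hq.2.1 ?_
        rw [e0, e1]
        exact hq'.2.1
    · rintro ⟨t, e⟩ hb
      simp only [Finset.coe_filter, Finset.mem_univ, true_and, Set.mem_ofPred_eq] at hb
      induction e using Sym2.ind with
      | _ u v =>
      have huv : u ≠ v := by simpa using hb.1
      by_cases h : O t u v
      · obtain ⟨π, hπ, rfl, rfl⟩ := exists_even_perm huv
        exact ⟨(t, π), Finset.mem_coe.2 ((memS _).2 ⟨hπ, h, hb.2⟩), rfl⟩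
      · have h' : O t v u := (hO t v u huv.symm).2 h
        obtain ⟨π, hπ, rfl, rfl⟩ := exists_even_perm huv.symm
        refine ⟨(t, π), Finset.mem_coe.2 ((memS _).2 ⟨hπ, h', ?_⟩), ?_⟩
        · rw [Sym2.eq_swap]; exact hb.2
        · simp only [Sym2.eq_swap]
    · intro q _; rfl
  have hmap : S.image M.rotate = S := by
    refine Finset.eq_of_subset_of_card_le ?_
      (Finset.card_image_of_injective _ M.rotate_injective).ge
    intro q' hq'
    obtain ⟨⟨t, π⟩, hq, rfl⟩ := Finset.mem_image.1 hq'
    obtain ⟨s1, s2, s3⟩ := (memS _).1 hq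
    have h03 : π 0 ≠ π 3 := fun h => by simpa using π.injective h
    have h13 : π 1 ≠ π 3 := fun h => by simpa using π.injective h
    have e0 : (M.rotate (t, π)).2 0 = M.glue t (π 3) (π 0) := by
      simp [rotate, Perm.mul_apply, swap_apply_of_ne_of_ne]
    have e1 : (M.rotate (t, π)).2 1 = M.glue t (π 3) (π 1) := by
      simp [rotate, Perm.mul_apply, swap_apply_of_ne_of_ne]
    rw [memS, M.sign_rotate, e0, e1]
    refine ⟨s1, hOglue _ _ _ _ h03 h13 s2, s3.trans _ _ _ (Relation.EqvGen.rel _ _ ?_)⟩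
    exact EdgeStep.step t (π 3) s(π 0, π 1) (by simp [h03.symm, h13.symm])
  have h2 : ∏ q ∈ S, Λ (M.rotate q) = ∏ q ∈ S, Λ q := by
    conv_rhs => rw [← hmap]
    rw [Finset.prod_image (fun _ _ _ _ h => M.rotate_injective h)]
  rw [Finset.prod_congr rfl fun q hq => hΛ q ((memS q).1 hq).1 ((memS q).1 hq).2.1,
    Finset.prod_mul_distrib] at h2
  rw [h1]
  refine mul_right_cancel₀ (Finset.prod_ne_zero_iff.2 fun q hq =>
    hne q ((memS q).1 hq).1 ((memS q).1 hq).2.1) (h2.trans (one_mul _).symm)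

/-- Developed positions for the links of the vertices in `K`: `pos t v a` is the corner on the edge
`v a` of the triangle cut off from `t` at `v`, drawn in `ℂ`. Every triangle has the shape prescribed
by `x`, and triangles sharing a side are drawn with this side the same up to translation, so that
`pos` describes a Euclidean structure on the links without rotational or dilational holonomy. -/
structure IsDeveloped (x : T → ℂ) (K : T → Fin 4 → Prop) (pos : T → Fin 4 → Fin 4 → ℂ) : Prop where
  glue_mem : ∀ t f v, v ≠ f → K t v → K (M.adj t f) (M.glue t f v)
  ne : ∀ t v a b, K t v → a ≠ v → b ≠ v → a ≠ b → pos t v a ≠ pos t v b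
  shape : ∀ t (π : Perm (Fin 4)), Perm.sign π = 1 → K t (π 0) →
    pos t (π 0) (π 2) - pos t (π 0) (π 1) =
      edgeParam (x t) s(π 0, π 1) * (pos t (π 0) (π 3) - pos t (π 0) (π 1))
  glue : ∀ t f v a b, K t v → v ≠ f → a ≠ f → b ≠ f → a ≠ v → b ≠ v →
    pos (M.adj t f) (M.glue t f v) (M.glue t f a) - pos (M.adj t f) (M.glue t f v) (M.glue t f b) =
      pos t v a - pos t v b

namespace IsDeveloped

variable {M} {x : T → ℂ} {K : T → Fin 4 → Prop} {pos : T → Fin 4 → Fin 4 → ℂ}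

/-- Turning around a corner multiplies the developed side by the parameter of the corner. -/
theorem rotate (h : M.IsDeveloped x K pos) (a : T × Perm (Fin 4)) (ha : Perm.sign a.2 = 1)
    (hK : K a.1 (a.2 0)) :
    pos (M.rotate a).1 ((M.rotate a).2 0) ((M.rotate a).2 1) -
        pos (M.rotate a).1 ((M.rotate a).2 0) ((M.rotate a).2 3) =
      edgeParam (x a.1) s(a.2 0, a.2 1) *
        (pos a.1 (a.2 0) (a.2 1) - pos a.1 (a.2 0) (a.2 3)) := by
  obtain ⟨t, π⟩ := a
  have e := h.glue t (π 3) (π 0) (π 1) (π 2) hK (by simp) (by simp) (by simp) (by simp) (by simp)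
  have e' := h.shape t π ha hK
  simp only [IdealTriangulation.rotate, Perm.mul_apply,
    show swap (2 : Fin 4) 3 0 = 0 by decide, show swap (2 : Fin 4) 3 1 = 1 by decide,
    show swap (2 : Fin 4) 3 3 = 2 by decide]
  linear_combination e - e'

/-- The derivative of the holonomy of a normal path is the quotient of the developed sides at its
ends. -/
theorem holonomy (h : M.IsDeveloped x K pos) {a b : T × Fin 4 × Fin 4} {c : ℂ}
    (hp : M.NormalPath x a b c) (hK : K a.1 a.2.1) (π ρ : Perm (Fin 4)) (hπ : Perm.sign π = 1)
    (hρ : Perm.sign ρ = 1) (ha : a.2 = (π 0, π 2)) (hb : b.2 = (ρ 0, ρ 2)) :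
    pos b.1 (ρ 0) (ρ 1) - pos b.1 (ρ 0) (ρ 3) =
      c * (pos a.1 (π 0) (π 1) - pos a.1 (π 0) (π 3)) := by
  induction hp generalizing π with
  | nil a =>
    rw [ha, Prod.mk.injEq] at hb
    rw [perm_eq_of_sign_eq' (hπ.trans hρ.symm) hb.1 hb.2, one_mul]
  | cons t τ b c hp ih =>
    simp only [Prod.mk.injEq] at ha hK
    have hK' := h.glue_mem t (τ 3) (τ 0) (by simp) hK
    rcases Int.units_eq_one_or (Perm.sign τ) with hτ | hτ
    · obtain rfl := perm_eq_of_sign_eq' (hπ.trans hτ.symm) ha.1.symm ha.2.symm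
      have := h.rotate (t, π) hπ hK
      rw [ih hK' (M.rotate (t, π)).2 (by rw [M.sign_rotate, hπ]) (by
        simp [IdealTriangulation.rotate, Perm.mul_apply, swap_apply_of_ne_of_ne]) hb]
      simp only [hτ, Units.val_one, zpow_one]
      refine (congrArg (c * ·) this).trans ?_
      simp only
      ring
    · -- a turn in the negative direction: compare with the even permutation of the same state
      have hπ' : π = τ * swap 1 3 := by
        refine perm_eq_of_sign_eq' ?_ ?_ ?_
        · simp [hπ, hτ, Perm.sign_mul]
        · simp [← ha.1, Perm.mul_apply, swap_apply_of_ne_of_ne]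
        · simp [← ha.2, Perm.mul_apply, swap_apply_of_ne_of_ne]
      have e1 := h.shape t (τ * swap 2 3) (by simp [hτ, Perm.sign_mul]) (by
        simpa [Perm.mul_apply, swap_apply_of_ne_of_ne] using hK)
      have e2 := h.glue t (τ 3) (τ 0) (τ 2) (τ 1) hK (by simp) (by simp) (by simp) (by simp)
        (by simp)
      have e3 := ih hK' (M.glue t (τ 3) * τ * (swap 1 2 * swap 2 3))
        (by simp [hτ, Perm.sign_mul, M.glue_odd])
        (by simp [Perm.mul_apply, swap_apply_of_ne_of_ne]) hb
      have n1 := h.ne t (τ 0) (τ 3) (τ 1) hK (by simp) (by simp) (by simp)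
      rw [e3, hπ']
      simp only [Perm.mul_apply, show swap (2 : Fin 4) 3 0 = 0 by decide,
        show swap (2 : Fin 4) 3 1 = 1 by decide, show swap (2 : Fin 4) 3 2 = 3 by decide,
        show swap (2 : Fin 4) 3 3 = 2 by decide, show swap (1 : Fin 4) 3 0 = 0 by decide,
        show swap (1 : Fin 4) 3 1 = 3 by decide, show swap (1 : Fin 4) 3 3 = 1 by decide,
        show swap (1 : Fin 4) 2 0 = 0 by decide, show swap (1 : Fin 4) 2 1 = 2 by decide,
        show swap (1 : Fin 4) 2 2 = 1 by decide] at e1 ⊢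
      have e0 : edgeParam (x t) s(τ 0, τ 1) ≠ 0 := by
        intro e0
        rw [e0, zero_mul] at e1
        exact n1 (sub_eq_zero.1 e1)
      rw [e2, hτ, e1]
      simp only [Units.val_neg, Units.val_one, Int.reduceNeg, zpow_neg, zpow_one]
      field_simp

theorem isComplete (h : M.IsDeveloped x K pos) : M.IsComplete x K := by
  intro t v f c hK hp
  by_cases hvf : v = f
  · -- no triangle at `v` has a side in the face `v`: such a path is trivial
    generalize ha : (t, v, f) = a at hp
    cases hp with
    | nil => rfl
    | cons t' π b c hp =>
      simp only [Prod.mk.injEq] at ha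
      simpa using π.injective (ha.2.1.symm.trans (hvf.trans ha.2.2))
  · obtain ⟨π, hπ, rfl, rfl⟩ : ∃ π : Perm (Fin 4), Perm.sign π = 1 ∧ π 0 = v ∧ π 2 = f := by
      clear hp hK; revert v f; decide
    have e := h.holonomy hp hK π π hπ hπ rfl rfl
    have n := h.ne t (π 0) (π 1) (π 3) hK (by simp) (by simp) (by simp)
    exact mul_right_cancel₀ (sub_ne_zero.2 n) (by simpa using e.symm)

end IsDeveloped

end IdealTriangulation

end

/-! ### Gluings of the octahedral triangulation -/

namespace Octahedron

open OctVertex Equiv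

/-- The names of the vertices of the face `(i, b)`: its vertex in `{A, C}`, its vertex in `{B, D}`,
its pole; the last entry is a dummy value. -/
def faceName (i : Fin 4) (b : Bool) : Fin 4 → OctVertex :=
  if i = 0 ∨ i = 2 then ![ring i, ring (if b then i + 1 else i + 3), pole i, E]
  else ![ring (if b then i + 1 else i + 3), ring i, pole i, E]

theorem vert_outerLabel {s : Bool} {i : Fin 4} {b : Bool} {m : Fin 4} (hm : m ≠ 3) :
    vert s (outerTet s i b) (outerLabel s i b m) = faceName i b m := by
  revert s i b m; decide

theorem vert_injective (s : Bool) (t : Fin 4) : Function.Injective (vert s t) := by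
  revert s t; decide

/-- A ranking of the vertices of an octahedron in which the poles precede `A`, `C` and these
precede `B`, `D`. -/
def rank : OctVertex → ℕ
  | E => 0
  | F => 1
  | A => 2
  | C => 3
  | B => 4
  | D => 5

theorem rank_injective : Function.Injective rank := by
  intro u v h
  cases u <;> cases v <;> first | rfl | simp [rank] at h

theorem rank_faceName {i i' m m' : Fin 4} {b b' : Bool} (hm : m ≠ 3) (hm' : m' ≠ 3)
    (h : rank (faceName i b m) < rank (faceName i b m')) :
    rank (faceName i' b' m) < rank (faceName i' b' m') := by
  revert i i' b b' m m'; decide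

theorem faceName_pole {i m : Fin 4} {b : Bool} (hm : m ≠ 3) :
    (faceName i b m = E ∨ faceName i b m = F) ↔ m = 2 := by
  revert i b m; decide

/-- In an octahedron subdivided by `EF`, the rotation about a horizontal edge, directed from
`{A, C}` to `{B, D}`, leaves through the face on the clockwise side of the next end. -/
theorem horizontal_of_false {t : Fin 4} {π : Perm (Fin 4)} (hπ : Perm.sign π = 1)
    (h : rank (vert false t (π 0)) < rank (vert false t (π 1)))
    (hp : ¬ (vert false t (π 0) = E ∨ vert false t (π 0) = F)) :
    faceKind false t (π 3) = .inr (t + 1, false) ∧ s(π 0, π 1) = s(2, 3) := by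
  revert t π; decide

/-- In an octahedron subdivided by `AC`, the rotation about an edge without pole either comes from an
inner face opposite to a pole and leaves through a face on the clockwise side of an end, or it goes
around the edge `AC`, or it leaves through an inner face opposite to a pole. -/
theorem horizontal_of_true {t : Fin 4} {π : Perm (Fin 4)} (hπ : Perm.sign π = 1)
    (h : rank (vert true t (π 0)) < rank (vert true t (π 1)))
    (hp : ¬ (vert true t (π 0) = E ∨ vert true t (π 0) = F)) :
    (π 2 = 0 ∧ faceKind true t (π 3) = .inr (![1, 3, 2, 0] t, false) ∨
      π 2 = 0 ∧ faceKind true t (π 3) = .inl (![1, 0, 3, 2] t) ∧ π 3 = 1) ∨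
      π 2 ≠ 0 ∧ π 3 = 0 ∧ faceKind true t (π 3) = .inl (t + 2) := by
  revert t π; decide

theorem edge_eq_of_zero {π : Perm (Fin 4)} (h : π 3 = 0) :
    s(π 0, π 1) = s(2, 3) ∨ s(π 0, π 1) = s(1, 2) ∨ s(π 0, π 1) = s(1, 3) := by
  revert π; decide

end Octahedron

namespace LinkDiagram

open Octahedron Equiv

variable {D : LinkDiagram} {s : D.Crossing → Bool}

theorem octahedral_inl {t : D.Crossing × Fin 4} {f t' : Fin 4}
    (h : faceKind (s t.1) t.2 f = .inl t') :
    (D.octahedral s).adj t f = (t.1, t') ∧ (D.octahedral s).glue t f = swap 2 3 := by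
  simp [octahedral, h]

theorem octahedral_inr {t : D.Crossing × Fin 4} {f i : Fin 4} {b : Bool}
    (h : faceKind (s t.1) t.2 f = .inr (i, b)) :
    (D.octahedral s).adj t f = ((D.across (t.1, i)).1,
        outerTet (s (D.across (t.1, i)).1) (D.across (t.1, i)).2 (!b)) ∧
      (D.octahedral s).glue t f = (outerLabel (s t.1) i b).symm.trans
        (outerLabel (s (D.across (t.1, i)).1) (D.across (t.1, i)).2 (!b)) := by
  simp [octahedral, h]

/-- The name of a vertex of a tetrahedron of the octahedral triangulation. -/
def vertexName (s : D.Crossing → Bool) (t : D.Crossing × Fin 4) (v : Fin 4) : OctVertex :=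
  vert (s t.1) t.2 v

/-- How a gluing acts on the names of vertices: an inner gluing preserves them, and a gluing along
a side replaces the names of the vertices of one face by those of the other. -/
theorem vertexName_glue (t : D.Crossing × Fin 4) (f : Fin 4) :
    (∃ t', (D.octahedral s).adj t f = (t.1, t') ∧ ∀ v, v ≠ f →
      vertexName s ((D.octahedral s).adj t f) ((D.octahedral s).glue t f v) =
        vertexName s t v) ∨
    ∃ (i : Fin 4) (b : Bool), ((D.octahedral s).adj t f).1 = (D.across (t.1, i)).1 ∧
      ∀ v, v ≠ f → ∃ m, m ≠ 3 ∧ v = outerLabel (s t.1) i b m ∧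
        vertexName s t v = faceName i b m ∧
        vertexName s ((D.octahedral s).adj t f) ((D.octahedral s).glue t f v) =
          faceName (D.across (t.1, i)).2 (!b) m := by
  rcases h : faceKind (s t.1) t.2 f with t' | ⟨i, b⟩
  · left
    obtain ⟨h1, h2⟩ := octahedral_inl h
    refine ⟨t', h1, fun v hv => ?_⟩
    rw [h1, h2]
    exact (inner_names _ _ _ _ h v hv).symm
  · right
    obtain ⟨h1, h2⟩ := octahedral_inr h
    obtain ⟨h3, h4⟩ := outer_of_faceKind _ _ _ _ _ h
    refine ⟨i, b, by rw [h1], fun v hv => ?_⟩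
    have hm : (outerLabel (s t.1) i b).symm v ≠ 3 := by
      intro hm
      rw [symm_apply_eq, h4] at hm
      exact hv hm
    refine ⟨(outerLabel (s t.1) i b).symm v, hm, by simp, ?_, ?_⟩
    · rw [← vert_outerLabel (s := s t.1) hm, h3, apply_symm_apply]
      rfl
    · rw [h1, h2, trans_apply]
      exact vert_outerLabel hm

theorem isLinkVertex_glue (t : D.Crossing × Fin 4) {f v : Fin 4} (hv : v ≠ f) :
    D.IsLinkVertex s ((D.octahedral s).adj t f) ((D.octahedral s).glue t f v) ↔
      D.IsLinkVertex s t v := by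
  rcases vertexName_glue (s := s) t f with ⟨t', -, h⟩ | ⟨i, b, -, h⟩
  · have h := h v hv
    unfold vertexName at h
    rw [IsLinkVertex, IsLinkVertex, h]
  · obtain ⟨m, hm, -, h1, h2⟩ := h v hv
    unfold vertexName at h1 h2
    rw [IsLinkVertex, IsLinkVertex, h1, h2, faceName_pole hm, faceName_pole hm]

/-- The difference of the developed positions of the two horizontal vertices of the face `(δ, b)`,
seen from its pole. -/
def gap (P : D.Crossing → OctVertex → OctVertex → ℂ) (δ : D.Dart) (b : Bool) : ℂ :=
  P δ.1 (pole δ.2) (faceName δ.2 b 0) - P δ.1 (pole δ.2) (faceName δ.2 b 1)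

/-- `P j p n` is a developed position of the vertex named `n` of the octahedron at `j`, seen from the
pole named `p`. As positions depend only on the names of the vertices, inner gluings are respected
automatically, and `gap_across` expresses that the outer ones are. -/
structure Positions (s : D.Crossing → Bool) (x : D.Crossing × Fin 4 → ℂ)
    (P : D.Crossing → OctVertex → OctVertex → ℂ) : Prop where
  ne : ∀ t v a b, D.IsLinkVertex s t v → a ≠ v → b ≠ v → a ≠ b →
    P t.1 (vertexName s t v) (vertexName s t a) ≠ P t.1 (vertexName s t v) (vertexName s t b)
  shape : ∀ t (π : Perm (Fin 4)), Perm.sign π = 1 → D.IsLinkVertex s t (π 0) →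
    P t.1 (vertexName s t (π 0)) (vertexName s t (π 2)) -
        P t.1 (vertexName s t (π 0)) (vertexName s t (π 1)) =
      edgeParam (x t) s(π 0, π 1) *
        (P t.1 (vertexName s t (π 0)) (vertexName s t (π 3)) -
          P t.1 (vertexName s t (π 0)) (vertexName s t (π 1)))
  gap_across : ∀ δ b, gap P (D.across δ) (!b) = gap P δ b

theorem Positions.isDeveloped {x : D.Crossing × Fin 4 → ℂ}
    {P : D.Crossing → OctVertex → OctVertex → ℂ} (h : D.Positions s x P) :
    (D.octahedral s).IsDeveloped x (D.IsLinkVertex s)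
      (fun t v a => P t.1 (vertexName s t v) (vertexName s t a)) where
  glue_mem t f v hv hK := (isLinkVertex_glue t hv).2 hK
  ne := h.ne
  shape := h.shape
  glue t f v a b hK hv ha hb hav hbv := by
    rcases vertexName_glue (s := s) t f with ⟨t', h1, h2⟩ | ⟨i, c, h1, h2⟩
    · rw [h2 v hv, h2 a ha, h2 b hb, h1]
    · obtain ⟨mv, nv, rfl, e1, e1'⟩ := h2 v hv
      obtain ⟨ma, na, rfl, e2, e2'⟩ := h2 a ha
      obtain ⟨mb, nb, rfl, e3, e3'⟩ := h2 b hb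
      have hmv : mv = 2 := by
        unfold vertexName at e1
        rw [IsLinkVertex, e1, faceName_pole nv] at hK
        exact hK
      subst hmv
      have ka : ma ≠ 2 := fun k => hav (by rw [k])
      have kb : mb ≠ 2 := fun k => hbv (by rw [k])
      rw [h1, e1, e1', e2, e2', e3, e3']
      have q := h.gap_across (t.1, i) c
      have p2 : ∀ i b, faceName i b 2 = pole i := by decide
      simp only [gap] at q
      rw [p2, p2]
      have : ∀ m : Fin 4, m ≠ 3 → m ≠ 2 → m = 0 ∨ m = 1 := by decide
      rcases this ma na ka with rfl | rfl <;> rcases this mb nb kb with rfl | rfl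
      · simp
      · exact q
      · linear_combination -q
      · simp

/-- The potential of a directed edge: for an edge starting at a pole, a developed side of its link
triangle; for another edge, a side variable `ζ`, divided by the parameter of the edge if the
rotation comes from an inner face opposite to a pole. For the remaining edges of the `t`-th
tetrahedron of an octahedron subdivided by `EF`, the relevant side is the one at the end `t`; around
an octahedron subdivided by `AC` all values of `ζ` will be equal, so that the choice is immaterial
there. -/
def edgePotential (s : D.Crossing → Bool) (x : D.Crossing × Fin 4 → ℂ)
    (P : D.Crossing → OctVertex → OctVertex → ℂ) (ζ : D.Dart → ℂ)
    (a : (D.Crossing × Fin 4) × Perm (Fin 4)) : ℂ :=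
  if D.IsLinkVertex s a.1 (a.2 0) then
    P a.1.1 (vertexName s a.1 (a.2 0)) (vertexName s a.1 (a.2 1)) -
      P a.1.1 (vertexName s a.1 (a.2 0)) (vertexName s a.1 (a.2 3))
  else ζ a.1 * if s a.1.1 = true ∧ a.2 2 = 0 then (edgeParam (x a.1) s(a.2 0, a.2 1))⁻¹ else 1

theorem edgeParam_ne_zero {x : ℂ} (h0 : x ≠ 0) (h1 : x ≠ 1) (e : Sym2 (Fin 4)) :
    edgeParam x e ≠ 0 := by
  unfold edgeParam
  split_ifs
  · exact h0
  · exact one_div_ne_zero (sub_ne_zero.2 h1.symm)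
  · rw [sub_ne_zero, ne_comm, Ne, div_eq_iff h0, one_mul]; exact h1.symm

/-- The potential is multiplicative along rotations about the edges without pole. In the product
over the corners of a region of the diagram, the parameters `ζ (j, i + 1) / ζ (j, i)` telescope. -/
theorem edgePotential_rotate_horizontal {x : D.Crossing × Fin 4 → ℂ}
    {P : D.Crossing → OctVertex → OctVertex → ℂ} {ζ : D.Dart → ℂ}
    (hx0 : ∀ t, x t ≠ 0) (hx1 : ∀ t, x t ≠ 1) (hζ0 : ∀ δ, ζ δ ≠ 0)
    (hζ : ∀ δ, ζ (D.across δ) = ζ δ)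
    (hfalse : ∀ j i, s j = false → x (j, i) = ζ (j, i + 1) / ζ (j, i))
    (htrue : ∀ j i, s j = true → ζ (j, i) = ζ (j, 0))
    (hinv : ∀ j i, s j = true → x (j, i + 2) = 1 / x (j, i))
    (a : (D.Crossing × Fin 4) × Perm (Fin 4)) (ha : Perm.sign a.2 = 1)
    (hO : rank (vertexName s a.1 (a.2 0)) < rank (vertexName s a.1 (a.2 1)))
    (hK : ¬ D.IsLinkVertex s a.1 (a.2 0)) :
    edgePotential s x P ζ ((D.octahedral s).rotate a) =
      edgeParam (x a.1) s(a.2 0, a.2 1) * edgePotential s x P ζ a := by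
  obtain ⟨⟨j, k⟩, π⟩ := a
  have hK' : ¬ D.IsLinkVertex s ((D.octahedral s).rotate ((j, k), π)).1
      (((D.octahedral s).rotate ((j, k), π)).2 0) := by
    have := (isLinkVertex_glue (s := s) (j, k) (f := π 3) (v := π 0) (by simp)).not.2 hK
    simpa [IdealTriangulation.rotate, Perm.mul_apply, swap_apply_of_ne_of_ne] using this
  have hr2 : ((D.octahedral s).rotate ((j, k), π)).2 2 =
      (D.octahedral s).glue (j, k) (π 3) (π 3) := by
    simp [IdealTriangulation.rotate, Perm.mul_apply]
  have hr0 : ((D.octahedral s).rotate ((j, k), π)).2 0 =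
      (D.octahedral s).glue (j, k) (π 3) (π 0) := by
    simp [IdealTriangulation.rotate, Perm.mul_apply, swap_apply_of_ne_of_ne]
  have hr1 : ((D.octahedral s).rotate ((j, k), π)).2 1 =
      (D.octahedral s).glue (j, k) (π 3) (π 1) := by
    simp [IdealTriangulation.rotate, Perm.mul_apply, swap_apply_of_ne_of_ne]
  have hr : ((D.octahedral s).rotate ((j, k), π)).1 = (D.octahedral s).adj (j, k) (π 3) := rfl
  have hpar := edgeParam_ne_zero (hx0 (j, k)) (hx1 (j, k)) s(π 0, π 1)
  rw [edgePotential, edgePotential, if_neg hK, if_neg hK']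
  simp only [hr0, hr1, hr2, hr]
  -- leaving the octahedron through a face `(i, false)`
  have hout : ∀ i, faceKind (s j) k (π 3) = .inr (i, false) →
      (ζ ((D.octahedral s).adj (j, k) (π 3)) *
        if s ((D.octahedral s).adj (j, k) (π 3)).1 = true ∧
          (D.octahedral s).glue (j, k) (π 3) (π 3) = 0 then
          (edgeParam (x ((D.octahedral s).adj (j, k) (π 3)))
            s((D.octahedral s).glue (j, k) (π 3) (π 0),
              (D.octahedral s).glue (j, k) (π 3) (π 1)))⁻¹ else 1) = ζ (j, i) := by
    intro i h
    obtain ⟨h1, h2⟩ := octahedral_inr (s := s) (t := (j, k)) h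
    have h3 : (outerLabel (s j) i false).symm (π 3) = 3 := by
      rw [← (outer_of_faceKind _ _ _ _ _ h).2, symm_apply_apply]
    rw [if_neg, mul_one, h1, ← hζ (j, i)]
    · rcases hs : s (D.across (j, i)).1 with _ | _
      · simp [outerTet]
      · rw [htrue _ _ hs, ← htrue _ (D.across (j, i)).2 hs]
    · rintro ⟨k1, k2⟩
      rw [h1] at k1
      simp only at k1
      rw [h2] at k2
      simp only [trans_apply, h3, Bool.not_false, k1] at k2
      revert k2
      generalize (D.across (j, i)).2 = i'
      revert i'
      decide
  rcases hs : s j with _ | _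
  · simp only [vertexName, hs, IsLinkVertex] at hO hK
    obtain ⟨h1, h2⟩ := horizontal_of_false ha hO hK
    rw [hout (k + 1) (by rw [hs]; exact h1)]
    simp only at h2
    rw [h2, edgeParam, if_pos (by simp), hfalse j k hs]
    simp
    rw [div_mul_cancel₀ _ (hζ0 _)]
  · simp only [vertexName, hs, IsLinkVertex] at hO hK
    obtain (⟨h1, h2⟩ | ⟨h1, h2, h3⟩) | ⟨h1, h2, h3⟩ := horizontal_of_true ha hO hK
    · rw [hout _ (by rw [hs]; exact h2), htrue j _ hs, htrue j k hs]
      simp only at h1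
      simp only [h1, and_self, if_true]
      field_simp
    · rw [← hs] at h2
      obtain ⟨e1, e2⟩ := octahedral_inl (s := s) (t := (j, k)) h2
      simp only at h1 h3
      rw [e1, e2, htrue j (![1, 0, 3, 2] k) hs, htrue j k hs]
      simp [h1, h3, hs, swap_apply_of_ne_of_ne]
      field_simp
    · rw [← hs] at h3
      obtain ⟨e1, e2⟩ := octahedral_inl (s := s) (t := (j, k)) h3
      simp only at h1 h2
      have h4 := edge_eq_of_zero h2
      rw [e1, e2, htrue j (k + 2) hs, htrue j k hs]
      have hmap : s(swap (2 : Fin 4) 3 (π 0), swap (2 : Fin 4) 3 (π 1)) =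
        Sym2.map (swap (2 : Fin 4) 3) s(π 0, π 1) := rfl
      have g0 := hx0 (j, k)
      have g1 : 1 - x (j, k) ≠ 0 := sub_ne_zero.2 (hx1 (j, k)).symm
      have g2 : x (j, k) - 1 ≠ 0 := sub_ne_zero.2 (hx1 (j, k))
      rw [hmap, hinv j k hs]
      simp only [h2, hs, true_and, if_neg h1]
      rw [if_pos (swap_apply_of_ne_of_ne (by decide) (by decide))]
      have : (edgeParam (1 / x (j, k)) (Sym2.map (swap (2 : Fin 4) 3) s(π 0, π 1)))⁻¹ =
          edgeParam (x (j, k)) s(π 0, π 1) := by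
        rcases h4 with h4 | h4 | h4 <;> rw [h4] <;>
          simp [edgeParam, swap_apply_of_ne_of_ne]
      rw [this]
      ring

/-- Developed positions at the poles yield all edges with an end on the link and completeness; side
variables that agree around the crossings in `G` yield the remaining edges. -/
theorem hyperbolicity_of_positions {G : Set D.Crossing} {x : D.Crossing × Fin 4 → ℂ}
    {P : D.Crossing → OctVertex → OctVertex → ℂ} {ζ : D.Dart → ℂ}
    (hP : D.Positions (D.subdivision G) x P)
    (hx0 : ∀ t, x t ≠ 0) (hx1 : ∀ t, x t ≠ 1) (hζ0 : ∀ δ, ζ δ ≠ 0)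
    (hζ : ∀ δ, ζ (D.across δ) = ζ δ)
    (hfalse : ∀ j ∉ G, ∀ i, x (j, i) = ζ (j, i + 1) / ζ (j, i))
    (htrue : ∀ j ∈ G, ∀ i, ζ (j, i) = ζ (j, 0))
    (hinv : ∀ j ∈ G, ∀ i, x (j, i + 2) = 1 / x (j, i)) :
    D.HyperbolicityEquations G x := by
  have hdev := hP.isDeveloped
  refine ⟨?_, hdev.isComplete⟩
  refine (D.octahedral _).edgeEquations_of_potential
    (O := fun t u v => rank (vertexName (D.subdivision G) t u) <
      rank (vertexName (D.subdivision G) t v))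
    (Λ := edgePotential (D.subdivision G) x P ζ) ?_ ?_ ?_ ?_
  · intro t u v huv
    have : rank (vertexName (D.subdivision G) t u) ≠ rank (vertexName (D.subdivision G) t v) :=
      fun h => huv (vert_injective _ _ (rank_injective h))
    omega
  · intro t f u v hu hv h
    rcases vertexName_glue (s := D.subdivision G) t f with ⟨t', -, h2⟩ | ⟨i, c, -, h2⟩
    · rwa [h2 u hu, h2 v hv]
    · obtain ⟨m, hm, -, e1, e1'⟩ := h2 u hu
      obtain ⟨m', hm', -, e2, e2'⟩ := h2 v hv
      rw [e1, e2] at h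
      rw [e1', e2']
      exact rank_faceName hm hm' h
  · intro a ha _
    unfold edgePotential
    split_ifs with hK h
    · exact sub_ne_zero.2 (hP.ne _ _ _ _ hK (by simp) (by simp) (by simp))
    · exact mul_ne_zero (hζ0 _) (inv_ne_zero (edgeParam_ne_zero (hx0 _) (hx1 _) _))
    · exact mul_ne_zero (hζ0 _) one_ne_zero
  · intro a ha hO
    by_cases hK : D.IsLinkVertex (D.subdivision G) a.1 (a.2 0)
    · have hK' : D.IsLinkVertex (D.subdivision G) ((D.octahedral (D.subdivision G)).rotate a).1
          (((D.octahedral (D.subdivision G)).rotate a).2 0) := by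
        have := (isLinkVertex_glue (s := D.subdivision G) a.1 (f := a.2 3) (v := a.2 0)
          (by simp)).2 hK
        simpa [IdealTriangulation.rotate, Perm.mul_apply, swap_apply_of_ne_of_ne] using this
      rw [edgePotential, edgePotential, if_pos hK, if_pos hK']
      exact hdev.rotate a ha hK
    · exact edgePotential_rotate_horizontal hx0 hx1 hζ0 hζ
        (fun j i h => hfalse j (by simpa [subdivision] using h) i)
        (fun j i h => htrue j (by simpa [subdivision] using h) i)
        (fun j i h => hinv j (by simpa [subdivision] using h) i) a ha hO hK

end LinkDiagram

/-! ### Paths around the strands -/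

namespace LinkDiagram

open Octahedron Equiv

variable {D : LinkDiagram}

section Paths

variable {s : D.Crossing → Bool} {x : D.Crossing × Fin 4 → ℂ}

/-- The state of a normal path that enters the octahedron at the end `δ` of a side, through the face
on the clockwise side of `δ`, near the pole of the strand. -/
def entry (s : D.Crossing → Bool) (δ : D.Dart) : (D.Crossing × Fin 4) × Fin 4 × Fin 4 :=
  ((δ.1, outerTet (s δ.1) δ.2 false), outerLabel (s δ.1) δ.2 false 2,
    outerLabel (s δ.1) δ.2 false 3)

theorem normalPath_inner {j : D.Crossing} {k k' : Fin 4} {π : Perm (Fin 4)}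
    {b : (D.Crossing × Fin 4) × Fin 4 × Fin 4} {c : ℂ} (h : faceKind (s j) k (π 3) = .inl k')
    (hp : (D.octahedral s).NormalPath x ((j, k'), swap 2 3 (π 0), swap 2 3 (π 3)) b c) :
    (D.octahedral s).NormalPath x ((j, k), π 0, π 2) b
      (edgeParam (x (j, k)) s(π 0, π 1) ^ ((Perm.sign π : ℤˣ) : ℤ) * c) := by
  obtain ⟨h1, h2⟩ := octahedral_inl (s := s) (t := (j, k)) h
  refine IdealTriangulation.NormalPath.cons _ _ _ _ ?_
  rw [h1, h2]
  exact hp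

theorem normalPath_outer {j : D.Crossing} {i : Fin 4} {π : Perm (Fin 4)}
    {b : (D.Crossing × Fin 4) × Fin 4 × Fin 4} {c : ℂ} (h0 : π 0 = outerLabel (s j) i true 2)
    (h3 : π 3 = outerLabel (s j) i true 3)
    (hp : (D.octahedral s).NormalPath x (entry s (D.across (j, i))) b c) :
    (D.octahedral s).NormalPath x ((j, outerTet (s j) i true), π 0, π 2) b
      (edgeParam (x (j, outerTet (s j) i true)) s(π 0, π 1) ^ ((Perm.sign π : ℤˣ) : ℤ) * c) := by
  obtain ⟨h1, h2⟩ := octahedral_inr (s := s) (t := (j, outerTet (s j) i true)) (f := π 3)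
    (by rw [h3]; exact faceKind_outer (s j) i true)
  refine IdealTriangulation.NormalPath.cons _ _ _ _ ?_
  rw [h1, h2, h0, h3]
  simpa [entry] using hp

/-- The derivative of the holonomy of the path that turns around the vertical edge between the
horizontal vertex at the end `δ` and the pole of its strand. -/
def turn (s : D.Crossing → Bool) (x : D.Crossing × Fin 4 → ℂ) (δ : D.Dart) : ℂ :=
  let y (b : Bool) (e : Sym2 (Fin 4)) : ℂ := edgeParam (x (δ.1, outerTet (s δ.1) δ.2 b)) e
  if δ.2 = 0 ∨ δ.2 = 2 then
    if s δ.1 = true then (y false s(0, 3) * y true s(0, 2))⁻¹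
    else (y false s(1, 3) * y true s(1, 2))⁻¹
  else if s δ.1 = true then y true s(0, 1) else y false s(0, 3) * y true s(0, 2)

theorem normalPath_two_steps {j : D.Crossing} {i : Fin 4} (π ρ : Perm (Fin 4))
    {b : (D.Crossing × Fin 4) × Fin 4 × Fin 4} {c : ℂ}
    (h1 : outerLabel (s j) i false 2 = π 0) (h2 : outerLabel (s j) i false 3 = π 2)
    (h3 : faceKind (s j) (outerTet (s j) i false) (π 3) = .inl (outerTet (s j) i true))
    (h4 : swap 2 3 (π 0) = ρ 0) (h5 : swap 2 3 (π 3) = ρ 2)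
    (h6 : ρ 0 = outerLabel (s j) i true 2) (h7 : ρ 3 = outerLabel (s j) i true 3)
    (hp : (D.octahedral s).NormalPath x (entry s (D.across (j, i))) b c) :
    (D.octahedral s).NormalPath x (entry s (j, i)) b
      (edgeParam (x (j, outerTet (s j) i false)) s(π 0, π 1) ^ ((Perm.sign π : ℤˣ) : ℤ) *
        (edgeParam (x (j, outerTet (s j) i true)) s(ρ 0, ρ 1) ^ ((Perm.sign ρ : ℤˣ) : ℤ) * c)) := by
  simp only [entry, h1, h2]
  refine normalPath_inner h3 ?_
  rw [h4, h5]
  exact normalPath_outer h6 h7 hp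

theorem normalPath_turn (δ : D.Dart) {b : (D.Crossing × Fin 4) × Fin 4 × Fin 4} {c : ℂ}
    (hp : (D.octahedral s).NormalPath x (entry s (D.across δ)) b c) :
    (D.octahedral s).NormalPath x (entry s δ) b (turn s x δ * c) := by
  obtain ⟨j, i⟩ := δ
  unfold turn
  by_cases hi : i = 0 ∨ i = 2 <;> rcases hs : s j with _ | _ <;>
    simp only [hi, if_true, if_false, Bool.false_eq_true]
  · have := normalPath_two_steps (s := s) (x := x) (j := j) (i := i)
      (mkPerm ![1, 3, 0, 2] ![2, 0, 3, 1] (by decide) (by decide))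
      (mkPerm ![1, 2, 3, 0] ![3, 0, 1, 2] (by decide) (by decide)) (b := b) (c := c)
      (by rw [hs]; clear hp; revert i; decide) (by rw [hs]; clear hp; revert i; decide)
      (by rw [hs]; clear hp; revert i; decide) (by decide) (by decide)
      (by rw [hs]; clear hp; revert i; decide) (by rw [hs]; clear hp; revert i; decide) hp
    rw [hs, show Perm.sign (mkPerm ![1, 3, 0, 2] ![2, 0, 3, 1] _ _) = -1 by decide,
      show Perm.sign (mkPerm ![1, 2, 3, 0] ![3, 0, 1, 2] _ _) = -1 by decide] at this
    convert this using 1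
    simp [mkPerm, mul_assoc, mul_comm]
  · have := normalPath_two_steps (s := s) (x := x) (j := j) (i := i)
      (mkPerm ![0, 3, 2, 1] ![0, 3, 2, 1] (by decide) (by decide))
      (mkPerm ![0, 2, 1, 3] ![0, 2, 1, 3] (by decide) (by decide)) (b := b) (c := c)
      (by rw [hs]; clear hp; revert i; decide) (by rw [hs]; clear hp; revert i; decide)
      (by rw [hs]; clear hp; revert i; decide) (by decide) (by decide)
      (by rw [hs]; clear hp; revert i; decide) (by rw [hs]; clear hp; revert i; decide) hp
    rw [hs, show Perm.sign (mkPerm ![0, 3, 2, 1] ![0, 3, 2, 1] _ _) = -1 by decide,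
      show Perm.sign (mkPerm ![0, 2, 1, 3] ![0, 2, 1, 3] _ _) = -1 by decide] at this
    convert this using 1
    simp [mkPerm, mul_assoc, mul_comm]
  · have := normalPath_two_steps (s := s) (x := x) (j := j) (i := i)
      (mkPerm ![0, 3, 1, 2] ![0, 2, 3, 1] (by decide) (by decide))
      (mkPerm ![0, 2, 3, 1] ![0, 3, 1, 2] (by decide) (by decide)) (b := b) (c := c)
      (by rw [hs]; clear hp; revert i; decide) (by rw [hs]; clear hp; revert i; decide)
      (by rw [hs]; clear hp; revert i; decide) (by decide) (by decide)
      (by rw [hs]; clear hp; revert i; decide) (by rw [hs]; clear hp; revert i; decide) hp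
    rw [hs, show Perm.sign (mkPerm ![0, 3, 1, 2] ![0, 2, 3, 1] _ _) = 1 by decide,
      show Perm.sign (mkPerm ![0, 2, 3, 1] ![0, 3, 1, 2] _ _) = 1 by decide] at this
    convert this using 1
    simp [mkPerm, mul_assoc]
  · -- below the strand, a single tetrahedron has the vertical edge
    have := normalPath_outer (s := s) (x := x) (j := j) (i := i) (π := 1) (b := b) (c := c)
      (by rw [hs]; clear hp; revert i; decide) (by rw [hs]; clear hp; revert i; decide) hp
    have h1 : entry s (j, i) = ((j, outerTet (s j) i true), (1 : Perm (Fin 4)) 0,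
        (1 : Perm (Fin 4)) 2) := by
      simp only [entry, hs]
      clear hp this
      refine Prod.ext (Prod.ext rfl ?_) (Prod.ext ?_ ?_) <;> simp only <;> revert i <;> decide
    rw [h1]
    convert this using 1
    simp [hs]

/-- The path around the strand of a side turns around one vertical edge at each end of the side;
completeness says that its holonomy has derivative `1`. -/
theorem turn_mul_turn_of_isComplete
    (h : (D.octahedral s).IsComplete x (D.IsLinkVertex s)) (δ : D.Dart) :
    turn s x δ * turn s x (D.across δ) = 1 := by
  have hp := normalPath_turn (s := s) (x := x) δ (normalPath_turn (D.across δ)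
    (by rw [D.across_across]; exact IdealTriangulation.NormalPath.nil (entry s δ)))
  have hK : D.IsLinkVertex s (entry s δ).1 (entry s δ).2.1 := by
    have := vert_outerLabel (s := s δ.1) (i := δ.2) (b := false) (m := 2) (by decide)
    simp only [IsLinkVertex, entry, this]
    exact (faceName_pole (by decide)).2 rfl
  simpa using h _ _ _ _ hK hp

end Paths

end LinkDiagram

/-! ### Shapes at the crossings -/

namespace LinkDiagram

open Octahedron Equiv

variable {D : LinkDiagram}

section Shapes

variable {G : Set D.Crossing} {z : D.Side → ℂ} {w : D.Crossing → Fin 3 → ℂ}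
  {x : D.Crossing × Fin 4 → ℂ}

theorem octParam_eq_prod {s : D.Crossing → Bool} {j : D.Crossing} {u v : OctVertex}
    (S : Finset (Fin 4 × Fin 4 × Fin 4))
    (hS : ∀ t k l, (vert (s j) t k = u ∧ vert (s j) t l = v) ↔ (t, k, l) ∈ S) :
    D.octParam s x j u v = ∏ p ∈ S, edgeParam (x (j, p.1)) s(p.2.1, p.2.2) := by
  simp only [octParam, hS]
  have := Finset.prod_ite_mem Finset.univ S fun p : Fin 4 × Fin 4 × Fin 4 =>
    edgeParam (x (j, p.1)) s(p.2.1, p.2.2)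
  rw [Finset.univ_inter] at this
  simp only [← this, Fintype.prod_prod_type]

theorem octParam_horizontal_of_false {s : D.Crossing → Bool} {j : D.Crossing} (hs : s j = false)
    (i : Fin 4) : D.octParam s x j (ring i) (ring (i + 1)) = x (j, i) := by
  rw [octParam_eq_prod {(i, 2, 3)} (by rw [hs]; revert i; decide)]
  simp [edgeParam]

theorem octParam_horizontal_of_true {s : D.Crossing → Bool} {j : D.Crossing} (hs : s j = true) :
    D.octParam s x j (ring 0) (ring 1) = (1 - 1 / x (j, 0)) * (1 / (1 - x (j, 2))) ∧
      D.octParam s x j (ring 2) (ring 3) = (1 - 1 / x (j, 1)) * (1 / (1 - x (j, 3))) := by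
  rw [octParam_eq_prod {(0, 3, 1), (2, 2, 1)} (by rw [hs]; decide),
    octParam_eq_prod {(1, 3, 1), (3, 2, 1)} (by rw [hs]; decide)]
  simp [edgeParam]

theorem octParam_vertical_of_true {s : D.Crossing → Bool} {j : D.Crossing} (hs : s j = true) :
    D.octParam s x j (ring 0) (pole 0) = (1 - 1 / x (j, 2)) * (1 / (1 - x (j, 3))) ∧
      D.octParam s x j (ring 1) (pole 1) = x (j, 0) ∧
      D.octParam s x j (ring 2) (pole 2) = 1 / (1 - x (j, 2)) * (1 - 1 / x (j, 3)) ∧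
      D.octParam s x j (ring 3) (pole 3) = x (j, 1) := by
  rw [octParam_eq_prod {(2, 2, 0), (3, 3, 0)} (by rw [hs]; decide),
    octParam_eq_prod {(0, 1, 0)} (by rw [hs]; decide),
    octParam_eq_prod {(2, 3, 0), (3, 2, 0)} (by rw [hs]; decide),
    octParam_eq_prod {(1, 1, 0)} (by rw [hs]; decide)]
  simp [edgeParam]

/-- The contribution of the crossing at the end `δ` of a side `k` to `exp (z_k ∂V/∂z_k)`. -/
def sideFactor (G : Set D.Crossing) (z : D.Side → ℂ) (w : D.Crossing → Fin 3 → ℂ) (δ : D.Dart) :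
    ℂ :=
  let a := D.zAt z δ.1
  let u := D.wAt w δ.1
  if δ.1 ∈ G then ![(u 0)⁻¹, u 1, (u 2)⁻¹, u 3] δ.2
  else ![(1 - a 1 / a 0) / (1 - a 3 / a 0), (1 - a 1 / a 2) / (1 - a 1 / a 0),
    (1 - a 3 / a 2) / (1 - a 1 / a 2), (1 - a 3 / a 0) / (1 - a 3 / a 2)] δ.2

theorem IsShapeAssignment.eq_of_notMem (h : D.IsShapeAssignment G z w x) {j : D.Crossing}
    (hj : j ∉ G) (i : Fin 4) : x (j, i) = D.zAt z j (i + 1) / D.zAt z j i := by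
  rw [← h.horizontal j hj i, octParam_horizontal_of_false (by simp [subdivision, hj])]

theorem IsShapeAssignment.inv_of_mem (h : D.IsShapeAssignment G z w x) {j : D.Crossing}
    (hj : j ∈ G) (i : Fin 4) : x (j, i + 2) = 1 / x (j, i) := by
  have hs : D.subdivision G j = true := by simp [subdivision, hj]
  have key : ∀ a b : ℂ, a ≠ 0 → b ≠ 1 → (1 - 1 / a) * (1 / (1 - b)) = 1 → b = 1 / a := by
    intro a b ha hb e
    have : 1 - b ≠ 0 := sub_ne_zero.2 hb.symm
    field_simp at e ⊢
    linear_combination e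
  have h0 := h.horizontal_degenerate j hj 0
  have h2 := h.horizontal_degenerate j hj 2
  replace h0 := (octParam_horizontal_of_true hs).1.symm.trans h0
  replace h2 := (octParam_horizontal_of_true hs).2.symm.trans h2
  have k0 := key _ _ (h.ne_zero (j, 0)) (h.ne_one (j, 2)) h0
  have k1 := key _ _ (h.ne_zero (j, 1)) (h.ne_one (j, 3)) h2
  fin_cases i
  · exact k0
  · exact k1
  · simp [k0]
  · simp [k1]

theorem IsShapeAssignment.wAt_eq (h : D.IsShapeAssignment G z w x) {j : D.Crossing}
    (hj : j ∈ G) :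
    D.wAt w j 0 = (1 - x (j, 0)) * (1 / (1 - 1 / x (j, 1))) ∧ D.wAt w j 1 = x (j, 0) ∧
    D.wAt w j 2 = 1 / (1 - 1 / x (j, 0)) * (1 - x (j, 1)) ∧ D.wAt w j 3 = x (j, 1) := by
  have hs : D.subdivision G j = true := by simp [subdivision, hj]
  have e2 : x (j, 2) = 1 / x (j, 0) := h.inv_of_mem hj 0
  have e3 : x (j, 3) = 1 / x (j, 1) := h.inv_of_mem hj 1
  obtain ⟨h0, h1, h2, h3⟩ := octParam_vertical_of_true (x := x) hs
  simp only [← h.vertical_degenerate j hj, h0, h1, h2, h3, e2, e3, one_div_one_div, and_self]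

/-- The factors of the side equations are the holonomies around the vertical edges. -/
theorem IsShapeAssignment.turn_eq (h : D.IsShapeAssignment G z w x) (δ : D.Dart) :
    turn (D.subdivision G) x δ = sideFactor G z w δ := by
  obtain ⟨j, i⟩ := δ
  by_cases hj : j ∈ G
  · have hs : D.subdivision G j = true := by simp [subdivision, hj]
    have e2 : x (j, 2) = 1 / x (j, 0) := h.inv_of_mem hj 0
    have e3 : x (j, 3) = 1 / x (j, 1) := h.inv_of_mem hj 1
    obtain ⟨w0, w1, w2, w3⟩ := h.wAt_eq hj
    simp only [turn, sideFactor, hs, hj, if_true, w0, w1, w2, w3]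
    fin_cases i <;> simp [outerTet, edgeParam, e2, e3, mul_comm]
  · have hs : D.subdivision G j = false := by simp [subdivision, hj]
    have e0 := h.eq_of_notMem hj 0
    have e1 := h.eq_of_notMem hj 1
    have e2 := h.eq_of_notMem hj 2
    have e3 := h.eq_of_notMem hj 3
    simp only [zero_add, show (1 : Fin 4) + 1 = 2 from rfl, show (2 : Fin 4) + 1 = 3 from rfl,
      show (3 : Fin 4) + 1 = 0 from rfl] at e0 e1 e2 e3
    simp only [turn, sideFactor, hs, hj, if_false, Bool.false_eq_true]
    fin_cases i <;> simp [outerTet, edgeParam, e0, e1, e2, e3, div_eq_mul_inv, mul_comm]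

theorem sideFactor_ne_one_of_under (h : D.IsShapeAssignment G z w x) (hz : D.Admissible G z w)
    (δ : D.Dart) (hδ : δ.2 = 1 ∨ δ.2 = 3) : sideFactor G z w δ ≠ 1 := by
  obtain ⟨j, i⟩ := δ
  simp only at hδ
  by_cases hj : j ∈ G
  · obtain ⟨w0, w1, w2, w3⟩ := h.wAt_eq hj
    rcases hδ with rfl | rfl
    · simpa [sideFactor, hj, w1] using h.ne_one (j, 0)
    · simpa [sideFactor, hj, w3] using h.ne_one (j, 1)
  · have hd := hz.2.1 j hj
    have n : ∀ i, D.zAt z j i ≠ 0 := fun i => hz.1 _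
    have key : ∀ a b c : ℂ, a ≠ 0 → b ≠ 0 → c ≠ 0 → b ≠ c →
        (1 - a / b) / (1 - a / c) ≠ 1 := by
      intro a b c ha hb hc hbc e
      have := eq_of_div_eq_one e
      field_simp at this
      exact hbc (mul_left_cancel₀ ha (by linear_combination this))
    rcases hδ with rfl | rfl
    · simpa [sideFactor, hj] using key _ _ _ (n 1) (n 2) (n 0) (hd 2 0 (by decide))
    · simpa [sideFactor, hj] using key _ _ _ (n 3) (n 0) (n 2) (hd 0 2 (by decide))

/-- If one end of a strand passing through a crossing has the factor `1`, so does the other one. -/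
theorem sideFactor_opposite (h : D.IsShapeAssignment G z w x) (hz : D.Admissible G z w)
    (j : D.Crossing) (i : Fin 4) (hi : sideFactor G z w (j, i) = 1) :
    sideFactor G z w (j, i + 2) = 1 := by
  by_cases hu : i = 1 ∨ i = 3
  · exact absurd hi (sideFactor_ne_one_of_under h hz (j, i) hu)
  have hi' : i = 0 ∨ i = 2 := by revert hu; clear hi; revert i; decide
  by_cases hj : j ∈ G
  · obtain ⟨w0, w1, w2, w3⟩ := h.wAt_eq hj
    have a0 := h.ne_zero (j, 0)
    have a1 := h.ne_zero (j, 1)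
    have b0 : 1 - x (j, 0) ≠ 0 := sub_ne_zero.2 (h.ne_one (j, 0)).symm
    have b1 : 1 - x (j, 1) ≠ 0 := sub_ne_zero.2 (h.ne_one (j, 1)).symm
    have b0' : x (j, 0) - 1 ≠ 0 := sub_ne_zero.2 (h.ne_one (j, 0))
    have b1' : x (j, 1) - 1 ≠ 0 := sub_ne_zero.2 (h.ne_one (j, 1))
    have k0 : D.wAt w j 0 = 1 ↔ x (j, 0) * x (j, 1) = 1 := by
      rw [w0]
      have : 1 - 1 / x (j, 1) = (x (j, 1) - 1) / x (j, 1) := by field_simp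
      rw [this]
      field_simp
      constructor <;> intro e <;> linear_combination -e
    have k2 : D.wAt w j 2 = 1 ↔ x (j, 0) * x (j, 1) = 1 := by
      rw [w2]
      have : 1 - 1 / x (j, 0) = (x (j, 0) - 1) / x (j, 0) := by field_simp
      rw [this]
      field_simp
      constructor <;> intro e <;> linear_combination -e
    rcases hi' with rfl | rfl
    · simp only [sideFactor, hj, if_true] at hi ⊢
      simp at hi ⊢
      exact k2.2 (k0.1 hi)
    · simp only [sideFactor, hj, if_true] at hi ⊢
      simp at hi ⊢
      exact k0.2 (k2.1 hi)
  · exfalso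
    have hd := hz.2.1 j hj
    have n : ∀ i, D.zAt z j i ≠ 0 := fun i => hz.1 _
    have key : ∀ a b c : ℂ, c ≠ 0 → a ≠ b → (1 - a / c) / (1 - b / c) ≠ 1 := by
      intro a b c hc hab e
      have := eq_of_div_eq_one e
      field_simp at this
      exact hab (by linear_combination -this)
    rcases hi' with rfl | rfl
    · exact key _ _ _ (n 0) (hd 1 3 (by decide)) (by simpa [sideFactor, hj] using hi)
    · exact key _ _ _ (n 2) (hd 3 1 (by decide)) (by simpa [sideFactor, hj] using hi)

/-- A factor `1` would propagate along the whole component of the link, but it cannot occur where the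
component passes under a crossing. Geometrically: the meridian has a nontrivial translation. -/
theorem sideFactor_ne_one (hD : D.EveryComponentOverAndUnder) (h : D.IsShapeAssignment G z w x)
    (hz : D.Admissible G z w)
    (hφ : ∀ δ, sideFactor G z w δ * sideFactor G z w (D.across δ) = 1) (δ : D.Dart) :
    sideFactor G z w δ ≠ 1 := by
  intro h1
  obtain ⟨n, hn⟩ := (hD δ).2
  have : ∀ n, sideFactor G z w (D.straight^[n] δ) = 1 := by
    intro n
    induction n with
    | zero => exact h1
    | succ n ih =>
      rw [Function.iterate_succ_apply']
      have := hφ (D.straight^[n] δ)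
      rw [ih, one_mul] at this
      exact sideFactor_opposite h hz _ _ this
  exact sideFactor_ne_one_of_under h hz _ hn (this n)

end Shapes

end LinkDiagram

/-! ### Developed links of the poles -/

/-- The even permutations fixing `0`. -/
theorem edge_rotations {π : Equiv.Perm (Fin 4)} (hπ : Equiv.Perm.sign π = 1) (h : π 0 = 0) :
    (π 1 = 1 ∧ π 2 = 2 ∧ π 3 = 3) ∨ (π 1 = 2 ∧ π 2 = 3 ∧ π 3 = 1) ∨
      (π 1 = 3 ∧ π 2 = 1 ∧ π 3 = 2) := by
  revert π; decide

/-- The even permutations taking `0` to `1`. -/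
theorem edge_rotations' {π : Equiv.Perm (Fin 4)} (hπ : Equiv.Perm.sign π = 1) (h : π 0 = 1) :
    (π 1 = 0 ∧ π 2 = 3 ∧ π 3 = 2) ∨ (π 1 = 3 ∧ π 2 = 2 ∧ π 3 = 0) ∨
      (π 1 = 2 ∧ π 2 = 0 ∧ π 3 = 3) := by
  revert π; decide

/-- The points `p a`, `a ≠ v`, of the plane form a triangle of the shape of the link of the vertex
`v` in an ideal tetrahedron with parameter `x`. -/
structure IsLinkTriangle (x : ℂ) (v : Fin 4) (p : Fin 4 → ℂ) : Prop where
  ne : ∀ a b, a ≠ v → b ≠ v → a ≠ b → p a ≠ p b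
  shape : ∀ π : Equiv.Perm (Fin 4), Equiv.Perm.sign π = 1 → π 0 = v →
    p (π 2) - p (π 1) = edgeParam x s(π 0, π 1) * (p (π 3) - p (π 1))

theorem isLinkTriangle_zero {x : ℂ} (h0 : x ≠ 0) (h1 : x ≠ 1) {p : Fin 4 → ℂ}
    (hp : p 2 - p 1 = x * (p 3 - p 1)) (hne : p 3 ≠ p 1) : IsLinkTriangle x 0 p := by
  have e : p 2 = x * (p 3 - p 1) + p 1 := by linear_combination hp
  have n1 := sub_ne_zero.2 hne
  have n2 : 1 - x ≠ 0 := sub_ne_zero.2 h1.symm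
  have h21 : p 2 ≠ p 1 := sub_ne_zero.1 (by rw [hp]; exact mul_ne_zero h0 n1)
  have h32 : p 3 ≠ p 2 := sub_ne_zero.1 (by
    rw [e, show p 3 - (x * (p 3 - p 1) + p 1) = (1 - x) * (p 3 - p 1) by ring]
    exact mul_ne_zero n2 n1)
  constructor
  · intro a b ha hb hab
    fin_cases a <;> fin_cases b <;> first
      | exact absurd rfl ha
      | exact absurd rfl hb
      | exact absurd rfl hab
      | exact h21
      | exact h21.symm
      | exact h32
      | exact h32.symm
      | exact hne
      | exact hne.symm
  · intro π hπ hv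
    rcases edge_rotations hπ hv with ⟨a, b, c⟩ | ⟨a, b, c⟩ | ⟨a, b, c⟩ <;>
      rw [hv, a, b, c, e] <;> simp [edgeParam]
    all_goals field_simp
    all_goals ring

theorem isLinkTriangle_one {x : ℂ} (h0 : x ≠ 0) (h1 : x ≠ 1) {p : Fin 4 → ℂ}
    (hp : p 3 - p 0 = x * (p 2 - p 0)) (hne : p 2 ≠ p 0) : IsLinkTriangle x 1 p := by
  have e : p 3 = x * (p 2 - p 0) + p 0 := by linear_combination hp
  have n1 := sub_ne_zero.2 hne
  have n2 : 1 - x ≠ 0 := sub_ne_zero.2 h1.symm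
  have h30 : p 3 ≠ p 0 := sub_ne_zero.1 (by rw [hp]; exact mul_ne_zero h0 n1)
  have h23 : p 2 ≠ p 3 := sub_ne_zero.1 (by
    rw [e, show p 2 - (x * (p 2 - p 0) + p 0) = (1 - x) * (p 2 - p 0) by ring]
    exact mul_ne_zero n2 n1)
  constructor
  · intro a b ha hb hab
    fin_cases a <;> fin_cases b <;> first
      | exact absurd rfl ha
      | exact absurd rfl hb
      | exact absurd rfl hab
      | exact h30
      | exact h30.symm
      | exact h23
      | exact h23.symm
      | exact hne
      | exact hne.symm
  · intro π hπ hv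
    rcases edge_rotations' hπ hv with ⟨a, b, c⟩ | ⟨a, b, c⟩ | ⟨a, b, c⟩ <;>
      rw [hv, a, b, c, e] <;> simp [edgeParam]
    all_goals field_simp
    all_goals ring

namespace LinkDiagram

open Octahedron Equiv

variable {D : LinkDiagram}

/-- The position of a vertex of the octahedron, where `q` gives the positions of the horizontal
vertices and the opposite pole is at the origin. -/
def ringPosition (q : Fin 4 → ℂ) : OctVertex → ℂ
  | .A => q 0
  | .B => q 1
  | .C => q 2
  | .D => q 3
  | _ => 0

theorem ringPosition_ring (q : Fin 4 → ℂ) (i : Fin 4) : ringPosition q (ring i) = q i := by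
  fin_cases i <;> rfl

/-- The positions seen from the upper pole (`qF`) and the lower pole (`qE`). -/
def polePosition (qE qF : D.Crossing → Fin 4 → ℂ) (j : D.Crossing) (p n : OctVertex) : ℂ :=
  ringPosition (if p = .F then qF j else qE j) n

variable {s : D.Crossing → Bool} {x : D.Crossing × Fin 4 → ℂ} {qE qF : D.Crossing → Fin 4 → ℂ}

theorem isLinkTriangle_polePosition (hx0 : ∀ t, x t ≠ 0) (hx1 : ∀ t, x t ≠ 1)
    (hE : ∀ j, s j = false → ∀ k, qE j k ≠ 0 ∧ qE j k = x (j, k) * qE j (k + 1))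
    (hF : ∀ j, s j = false → ∀ k, qF j k ≠ 0 ∧ qF j (k + 1) = x (j, k) * qF j k)
    (hE' : ∀ j, s j = true → (qE j 0 ≠ qE j 1 ∧ qE j 2 - qE j 1 = x (j, 0) * (qE j 0 - qE j 1)) ∧
      (qE j 2 ≠ qE j 3 ∧ qE j 0 - qE j 3 = x (j, 1) * (qE j 2 - qE j 3)))
    (hF' : ∀ j, s j = true → (qF j 2 ≠ qF j 1 ∧ qF j 0 - qF j 1 = x (j, 2) * (qF j 2 - qF j 1)) ∧
      (qF j 0 ≠ qF j 3 ∧ qF j 2 - qF j 3 = x (j, 3) * (qF j 0 - qF j 3)))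
    (t : D.Crossing × Fin 4) (v : Fin 4) (hv : D.IsLinkVertex s t v) :
    IsLinkTriangle (x t) v
      (fun a => polePosition qE qF t.1 (vertexName s t v) (vertexName s t a)) := by
  obtain ⟨j, k⟩ := t
  rcases hs : s j with _ | _
  · have hpole : ∀ q, ringPosition q .E = 0 ∧ ringPosition q .F = 0 := fun q => ⟨rfl, rfl⟩
    have hv' : v = 0 ∨ v = 1 := by
      simp only [IsLinkVertex, hs] at hv
      revert k v; decide
    rcases hv' with rfl | rfl
    · refine isLinkTriangle_zero (hx0 _) (hx1 _) ?_ ?_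
      · simpa [polePosition, vertexName, hs, vert, ringPosition_ring, hpole]
          using (hE j hs k).2
      · simpa [polePosition, vertexName, hs, vert, ringPosition_ring, hpole]
          using (hE j hs (k + 1)).1
    · refine isLinkTriangle_one (hx0 _) (hx1 _) ?_ ?_
      · simpa [polePosition, vertexName, hs, vert, ringPosition_ring, hpole]
          using (hF j hs k).2
      · simpa [polePosition, vertexName, hs, vert, ringPosition_ring, hpole]
          using (hF j hs k).1
  · have hv' : v = 0 := by
      simp only [IsLinkVertex, hs] at hv
      revert k v; decide
    subst hv'
    obtain ⟨⟨a1, a2⟩, a3, a4⟩ := hE' j hs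
    obtain ⟨⟨b1, b2⟩, b3, b4⟩ := hF' j hs
    refine isLinkTriangle_zero (hx0 _) (hx1 _) ?_ ?_ <;> fin_cases k <;>
      simpa [polePosition, vertexName, hs, vert, ringPosition]

theorem gap_polePosition (j : D.Crossing) (i : Fin 4) (b : Bool) :
    gap (polePosition qE qF) (j, i) b =
      if i = 0 ∨ i = 2 then qF j i - qF j (if b then i + 1 else i + 3)
      else qE j (if b then i + 1 else i + 3) - qE j i := by
  fin_cases i <;> cases b <;> rfl

/-- At each end of a side, the two developed link sides `gap P δ true` and `gap P δ false` have the
quotient `φ δ`, and their difference, the translation of the meridian, is normalized to `-1` at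
outgoing and `1` at incoming ends. As `φ δ ≠ 1`, this determines both of them, and they match along
the side as soon as the factors at its ends are inverse to each other. -/
theorem gap_across_of_factor {P : D.Crossing → OctVertex → OctVertex → ℂ} {φ : D.Dart → ℂ}
    (hφ1 : ∀ δ, φ δ ≠ 1) (hφ : ∀ δ, φ δ * φ (D.across δ) = 1)
    (hratio : ∀ δ, gap P δ true = φ δ * gap P δ false)
    (hmeridian : ∀ δ, gap P δ true - gap P δ false = if dartOut D.positive δ then -1 else 1)
    (δ : D.Dart) (b : Bool) : gap P (D.across δ) (!b) = gap P δ b := by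
  have h1 := hratio δ
  have h2 := hratio (D.across δ)
  have h3 := hmeridian δ
  have h4 := hmeridian (D.across δ)
  have h5 := hφ δ
  have n1 := sub_ne_zero.2 (hφ1 δ)
  have h6 : gap P (D.across δ) true - gap P (D.across δ) false =
      -(gap P δ true - gap P δ false) := by
    rw [h3, h4, D.out_across]
    cases dartOut D.positive δ <;> simp
  rw [h1, h2] at h6
  have key : gap P (D.across δ) true = gap P δ false := by
    refine mul_left_cancel₀ n1 ?_
    rw [h2]
    linear_combination gap P (D.across δ) false * h5 - h6
  cases b
  · exact key
  · rw [Bool.not_true, h1, ← key, h2]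
    linear_combination -gap P (D.across δ) false * h5

section Assignment

variable {G : Set D.Crossing} {z : D.Side → ℂ} {w : D.Crossing → Fin 3 → ℂ}

/-- The corners `A, B, C, D` of the link of the lower pole, up to similarity; at a non-degenerate
crossing with the corner on `EF` at the origin. -/
def lowerQuad (G : Set D.Crossing) (z : D.Side → ℂ) (x : D.Crossing × Fin 4 → ℂ)
    (j : D.Crossing) : Fin 4 → ℂ :=
  if j ∈ G then ![0, 1 / (1 - x (j, 0)), 1, x (j, 1) / (x (j, 1) - 1)]
  else fun i => (D.zAt z j i)⁻¹

/-- The corners `A, B, C, D` of the link of the upper pole, up to similarity; at a non-degenerate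
crossing with the corner on `EF` at the origin. -/
def upperQuad (G : Set D.Crossing) (z : D.Side → ℂ) (x : D.Crossing × Fin 4 → ℂ)
    (j : D.Crossing) : Fin 4 → ℂ :=
  if j ∈ G then ![0, 1 / (1 - x (j, 0)), 1, x (j, 1) / (x (j, 1) - 1)]
  else D.zAt z j

/-- The link of the lower pole, scaled such that the diagonal from `C` to `A`, the translation of the
meridian, is `1` at a positive crossing and `-1` at a negative one. -/
def lowerPosition (G : Set D.Crossing) (z : D.Side → ℂ) (x : D.Crossing × Fin 4 → ℂ)
    (j : D.Crossing) (i : Fin 4) : ℂ :=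
  (if D.positive j then 1 else -1) / (lowerQuad G z x j 0 - lowerQuad G z x j 2) *
    lowerQuad G z x j i

/-- The link of the upper pole, scaled such that the diagonal from `D` to `B`, the translation of the
meridian, is `1`. -/
def upperPosition (G : Set D.Crossing) (z : D.Side → ℂ) (x : D.Crossing × Fin 4 → ℂ)
    (j : D.Crossing) (i : Fin 4) : ℂ :=
  1 / (upperQuad G z x j 1 - upperQuad G z x j 3) * upperQuad G z x j i

theorem lowerQuad_diagonal (hz : D.Admissible G z w) (j : D.Crossing) :
    lowerQuad G z x j 0 - lowerQuad G z x j 2 ≠ 0 := by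
  by_cases hj : j ∈ G
  · simp [lowerQuad, hj]
  · simp only [lowerQuad, hj, if_false, sub_ne_zero]
    exact fun h => hz.2.1 j hj 0 2 (by decide) (inv_injective h)

theorem upperQuad_diagonal (h : D.IsShapeAssignment G z w x) (hz : D.Admissible G z w)
    (j : D.Crossing) (hφ : sideFactor G z w (j, 0) ≠ 1) :
    upperQuad G z x j 1 - upperQuad G z x j 3 ≠ 0 := by
  by_cases hj : j ∈ G
  · have b0 : 1 - x (j, 0) ≠ 0 := sub_ne_zero.2 (h.ne_one (j, 0)).symm
    have b1 : x (j, 1) - 1 ≠ 0 := sub_ne_zero.2 (h.ne_one (j, 1))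
    have a1 := h.ne_zero (j, 1)
    simp [upperQuad, hj]
    intro e
    apply hφ
    simp [sideFactor, hj, (h.wAt_eq hj).1]
    have : 1 - (x (j, 1))⁻¹ = (x (j, 1) - 1) / x (j, 1) := by field_simp
    rw [this]
    field_simp at e ⊢
    linear_combination e
  · simp only [upperQuad, hj, if_false, sub_ne_zero]
    exact hz.2.1 j hj 1 3 (by decide)

/-- If the factors at the two ends of every side are inverse to each other, the scaled link
quadrilaterals fit together along all sides. -/
theorem positions_of_factor (hD : D.EveryComponentOverAndUnder)
    (h : D.IsShapeAssignment G z w x) (hz : D.Admissible G z w)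
    (hφ : ∀ δ, sideFactor G z w δ * sideFactor G z w (D.across δ) = 1) :
    D.Positions (D.subdivision G) x (polePosition (lowerPosition G z x) (upperPosition G z x)) := by
  have hφ1 := sideFactor_ne_one hD h hz hφ
  have dE : ∀ j, lowerQuad G z x j 0 - lowerQuad G z x j 2 ≠ 0 := lowerQuad_diagonal hz
  have dF : ∀ j, upperQuad G z x j 1 - upperQuad G z x j 3 ≠ 0 := fun j =>
    upperQuad_diagonal h hz j (hφ1 (j, 0))
  have zne : ∀ j i, D.zAt z j i ≠ 0 := fun j i => hz.1 _
  have εne : ∀ j, (if D.positive j then (1 : ℂ) else -1) ≠ 0 := by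
    intro j; split_ifs <;> simp
  have tri : ∀ t v, D.IsLinkVertex (D.subdivision G) t v → IsLinkTriangle (x t) v
      (fun a => polePosition (lowerPosition G z x) (upperPosition G z x) t.1
        (vertexName (D.subdivision G) t v) (vertexName (D.subdivision G) t a)) := by
    refine isLinkTriangle_polePosition h.ne_zero h.ne_one ?_ ?_ ?_ ?_
    · intro j hs k
      have hj : j ∉ G := by simpa [subdivision] using hs
      have e := h.eq_of_notMem hj k
      have n := zne j k
      have n' := zne j (k + 1)
      constructor
      · refine mul_ne_zero (div_ne_zero (εne j) (dE j)) ?_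
        simpa [lowerQuad, hj] using n
      · rw [lowerPosition, lowerPosition, e]
        generalize (if D.positive j then (1 : ℂ) else -1) /
          (lowerQuad G z x j 0 - lowerQuad G z x j 2) = μ
        simp only [lowerQuad, hj, if_false]
        field_simp
    · intro j hs k
      have hj : j ∉ G := by simpa [subdivision] using hs
      have e := h.eq_of_notMem hj k
      have n := zne j k
      constructor
      · refine mul_ne_zero (div_ne_zero one_ne_zero (dF j)) ?_
        simpa [upperQuad, hj] using n
      · rw [upperPosition, upperPosition, e]
        generalize 1 / (upperQuad G z x j 1 - upperQuad G z x j 3) = μ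
        simp only [upperQuad, hj, if_false]
        field_simp
    · intro j hs
      have hj : j ∈ G := by simpa [subdivision] using hs
      have b0 : 1 - x (j, 0) ≠ 0 := sub_ne_zero.2 (h.ne_one (j, 0)).symm
      have b1 : x (j, 1) - 1 ≠ 0 := sub_ne_zero.2 (h.ne_one (j, 1))
      have hμ := div_ne_zero (εne j) (dE j)
      simp only [lowerPosition]
      generalize (if D.positive j then (1 : ℂ) else -1) /
        (lowerQuad G z x j 0 - lowerQuad G z x j 2) = μ at hμ
      simp [lowerQuad, hj]
      refine ⟨⟨⟨hμ, b0⟩, ?_⟩, ?_, ?_⟩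
      · field_simp; ring
      · intro e
        field_simp at e
        simp at e
      · field_simp; ring
    · intro j hs
      have hj : j ∈ G := by simpa [subdivision] using hs
      have b0 : 1 - x (j, 0) ≠ 0 := sub_ne_zero.2 (h.ne_one (j, 0)).symm
      have b1 : x (j, 1) - 1 ≠ 0 := sub_ne_zero.2 (h.ne_one (j, 1))
      have a0 := h.ne_zero (j, 0)
      have a1 := h.ne_zero (j, 1)
      have hμ := div_ne_zero one_ne_zero (dF j)
      have e2 : x (j, 2) = 1 / x (j, 0) := h.inv_of_mem hj 0
      have e3 : x (j, 3) = 1 / x (j, 1) := h.inv_of_mem hj 1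
      simp only [upperPosition]
      generalize 1 / (upperQuad G z x j 1 - upperQuad G z x j 3) = μ at hμ
      simp [upperQuad, hj, e2, e3]
      refine ⟨⟨?_, ?_⟩, ?_, ?_⟩
      · intro e
        field_simp at e
        simp [h.ne_zero] at e
      · field_simp; ring
      · exact ⟨hμ, a1, b1⟩
      · field_simp; ring
  refine ⟨fun t v a b hv => (tri t v hv).ne a b,
    fun t π hπ hv => (tri t (π 0) hv).shape π hπ rfl, ?_⟩
  refine gap_across_of_factor hφ1 hφ ?_ ?_
  · rintro ⟨j, i⟩
    rw [gap_polePosition, gap_polePosition]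
    simp only [upperPosition, lowerPosition]
    generalize 1 / (upperQuad G z x j 1 - upperQuad G z x j 3) = μ
    generalize (if D.positive j then (1 : ℂ) else -1) /
      (lowerQuad G z x j 0 - lowerQuad G z x j 2) = ν
    by_cases hj : j ∈ G
    · have b0 : 1 - x (j, 0) ≠ 0 := sub_ne_zero.2 (h.ne_one (j, 0)).symm
      have b1 : x (j, 1) - 1 ≠ 0 := sub_ne_zero.2 (h.ne_one (j, 1))
      have a0 := h.ne_zero (j, 0)
      have a1 := h.ne_zero (j, 1)
      have b1' : 1 - x (j, 1) ≠ 0 := sub_ne_zero.2 (h.ne_one (j, 1)).symm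
      have b0' : x (j, 0) - 1 ≠ 0 := sub_ne_zero.2 (h.ne_one (j, 0))
      have c0 : 1 - (x (j, 0))⁻¹ = (x (j, 0) - 1) / x (j, 0) := by field_simp
      have c1 : 1 - (x (j, 1))⁻¹ = (x (j, 1) - 1) / x (j, 1) := by field_simp
      obtain ⟨w0, w1, w2, w3⟩ := h.wAt_eq hj
      fin_cases i <;> simp [upperQuad, lowerQuad, sideFactor, hj, w0, w1, w2, w3, c0, c1]
      all_goals field_simp
      all_goals try ring
    · have hd := hz.2.1 j hj
      have frac : ∀ a b c : ℂ, a ≠ 0 → (1 - b / a) / (1 - c / a) = (a - b) / (a - c) := by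
        intro a b c ha
        rw [← mul_div_mul_left _ _ ha]
        congr 1 <;> field_simp
      have frac' : ∀ a b c : ℂ, a ≠ 0 → b ≠ 0 → c ≠ 0 →
          (1 - b / a) / (1 - b / c) = (a⁻¹ - b⁻¹) / (c⁻¹ - b⁻¹) := by
        intro a b c ha hb hc
        rw [← mul_div_mul_left (a⁻¹ - b⁻¹) _ (neg_ne_zero.2 hb)]
        congr 1 <;> field_simp <;> ring
      have key : ∀ μ a b c : ℂ, a ≠ c → μ * a - μ * b = (a - b) / (a - c) * (μ * a - μ * c) := by
        intro μ a b c hac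
        have := sub_ne_zero.2 hac
        field_simp
      have key' : ∀ μ a b c : ℂ, c ≠ b → μ * a - μ * b = (a - b) / (c - b) * (μ * c - μ * b) := by
        intro μ a b c hac
        have := sub_ne_zero.2 hac
        field_simp
      fin_cases i <;> simp [upperQuad, lowerQuad, sideFactor, hj]
      · rw [frac _ _ _ (zne j 0)]
        exact key _ _ _ _ (hd 0 3 (by decide))
      · rw [frac' _ _ _ (zne j 2) (zne j 1) (zne j 0)]
        exact key' _ _ _ _ fun e => hd 0 1 (by decide) (inv_injective e)
      · rw [frac _ _ _ (zne j 2)]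
        exact key _ _ _ _ (hd 2 1 (by decide))
      · rw [frac' _ _ _ (zne j 0) (zne j 3) (zne j 2)]
        exact key' _ _ _ _ fun e => hd 2 3 (by decide) (inv_injective e)
  · rintro ⟨j, i⟩
    have e1 : upperPosition G z x j 1 - upperPosition G z x j 3 = 1 := by
      rw [upperPosition, upperPosition, ← mul_sub, one_div_mul_cancel (dF j)]
    have e2 : lowerPosition G z x j 0 - lowerPosition G z x j 2 =
        if D.positive j then 1 else -1 := by
      rw [lowerPosition, lowerPosition, ← mul_sub, div_mul_cancel₀ _ (dE j)]
    rw [gap_polePosition, gap_polePosition]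
    fin_cases i <;> simp [dartOut]
    · linear_combination -e1
    · by_cases hp : D.positive j = true <;> simp [hp] at e2 ⊢ <;> linear_combination -e2
    · linear_combination e1
    · by_cases hp : D.positive j = true <;> simp [hp] at e2 ⊢ <;> linear_combination e2

end Assignment

end LinkDiagram

/-! ### The equations of the side variables -/

theorem IsLogBranch.exp_eq {ℓ : ℂ → ℂ} {u : ℂ} (h : IsLogBranch ℓ u) : Complex.exp (ℓ u) = u :=
  (Filter.Eventually.self_of_nhds h).2

theorem IsLogBranch.hasDerivAt {ℓ : ℂ → ℂ} {u : ℂ} (h : IsLogBranch ℓ u) :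
    HasDerivAt ℓ u⁻¹ u := by
  have h1 := (Filter.Eventually.self_of_nhds h).1.hasDerivAt
  have h2 : HasDerivAt (fun x => Complex.exp (ℓ x)) 1 u :=
    (hasDerivAt_id u).congr_of_eventuallyEq (h.mono fun x hx => hx.2)
  have h3 := h1.cexp.unique h2
  rw [h.exp_eq] at h3
  rwa [← eq_inv_of_mul_eq_one_right h3]

/-- The logarithmic derivative of a dilogarithm of a quotient `A / B`. -/
theorem IsDilogBranch.hasDerivAt_div {L : ℂ → ℂ} {A B : ℂ → ℂ} {t e e' : ℂ}
    (h : IsDilogBranch L (A t / B t)) (hA : HasDerivAt A e t) (hB : HasDerivAt B e' t)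
    (ha : A t ≠ 0) (hb : B t ≠ 0) :
    ∃ m, Complex.exp m = 1 - A t / B t ∧
      HasDerivAt (fun y => L (A y / B y)) (-m * (e / A t - e' / B t)) t := by
  obtain ⟨γ, μ, m, -, -, -, -, -, -, -, h1, -, -, h2⟩ := h
  refine ⟨m (A t / B t), (Filter.Eventually.self_of_nhds h1).2, ?_⟩
  have h4 : HasDerivAt (fun y => A y / B y) ((e * B t - A t * e') / B t ^ 2) t := hA.div hB hb
  have h3 := HasDerivAt.comp t (h₂ := L) (Filter.Eventually.self_of_nhds h2 : _) h4
  refine h3.congr_deriv ?_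
  field_simp

namespace LinkDiagram

variable {D : LinkDiagram}

theorem side_of_out {δ : D.Dart} (h : dartOut D.positive δ = true) : D.side δ = ⟨δ, h⟩ :=
  dif_pos h

theorem side_of_not_out {δ : D.Dart} (h : ¬ dartOut D.positive δ = true) :
    D.side δ = ⟨D.across δ, by rw [D.out_across]; simpa using h⟩ :=
  dif_neg h

theorem side_across (δ : D.Dart) : D.side (D.across δ) = D.side δ := by
  have h := D.out_across δ
  by_cases hδ : dartOut D.positive δ = true
  · have h' : ¬ dartOut D.positive (D.across δ) = true := by simp [h, hδ]
    rw [side_of_not_out h', side_of_out hδ]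
    exact Subtype.ext (D.across_across δ)
  · have h' : dartOut D.positive (D.across δ) = true := by simpa [h] using hδ
    rw [side_of_out h', side_of_not_out hδ]

theorem across_ne (δ : D.Dart) : D.across δ ≠ δ := by
  intro h
  have := D.out_across δ
  rw [h] at this
  simp at this

theorem side_eq_iff (k : D.Side) (δ : D.Dart) : D.side δ = k ↔ δ = k.1 ∨ δ = D.across k.1 := by
  constructor
  · rintro rfl
    by_cases hδ : dartOut D.positive δ = true
    · rw [side_of_out hδ]
      exact Or.inl rfl
    · rw [side_of_not_out hδ]
      exact Or.inr (D.across_across δ).symm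
  · have : D.side k.1 = k := side_of_out k.2
    rintro (rfl | rfl)
    · exact this
    · rw [side_across, this]

variable {G : Set D.Crossing} {z : D.Side → ℂ} {w : D.Crossing → Fin 3 → ℂ}

/-- The summand of the potential function at a crossing. -/
def Branches.term (b : D.Branches G z w) (j : D.Crossing) (z' : D.Side → ℂ)
    (w' : D.Crossing → Fin 3 → ℂ) : ℂ :=
  if j ∈ G then
    -(b.logw j 0 (D.wAt w' j 0) * b.logz j 0 (D.zAt z' j 0))
      + b.logw j 1 (D.wAt w' j 1) * b.logz j 1 (D.zAt z' j 1)
      - b.logw j 2 (D.wAt w' j 2) * b.logz j 2 (D.zAt z' j 2)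
      + b.logw j 3 (D.wAt w' j 3) * b.logz j 3 (D.zAt z' j 3)
  else
    b.li j 0 (D.dilogArg z' j 0) - b.li j 1 (D.dilogArg z' j 1)
      + b.li j 2 (D.dilogArg z' j 2) - b.li j 3 (D.dilogArg z' j 3)

theorem Branches.V_eq_sum (b : D.Branches G z w) (z' : D.Side → ℂ)
    (w' : D.Crossing → Fin 3 → ℂ) : b.V z' w' = ∑ j, b.term j z' w' := rfl

theorem hasDerivAt_zAt (k : D.Side) (j : D.Crossing) (i : Fin 4) :
    HasDerivAt (fun t => D.zAt (Function.update z k t) j i)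
      (if D.side (j, i) = k then 1 else 0) (z k) := by
  unfold zAt
  by_cases h : D.side (j, i) = k
  · simp only [h, if_true, Function.update_self]
    exact hasDerivAt_id _
  · simp only [h, if_false, Function.update_of_ne, ne_eq, not_false_eq_true]
    exact hasDerivAt_const _ _

/-- The logarithmic derivative of a summand of `V` with respect to `z_k` is a sum over the ends of `k`
at the crossing, both ends contributing if `k` is a loop; the contributions are logarithms of
`sideFactor`, for every choice of branches. -/
theorem Branches.hasDerivAt_term_z (b : D.Branches G z w) (hz : D.Admissible G z w)
    (k : D.Side) (j : D.Crossing) :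
    ∃ (c : Fin 4 → ℂ) (d : ℂ), (∀ i, Complex.exp (c i) = sideFactor G z w (j, i)) ∧
      HasDerivAt (fun t => b.term j (Function.update z k t) w) d (z k) ∧
      z k * d = ∑ i, c i * if D.side (j, i) = k then 1 else 0 := by
  have hA := hasDerivAt_zAt (z := z) k j
  have hself : ∀ i, D.zAt (Function.update z k (z k)) j i = D.zAt z j i := by
    intro i; rw [Function.update_eq_self]
  have hne : ∀ i, D.zAt z j i ≠ 0 := fun i => hz.1 _
  have hr : ∀ i, z k * ((if D.side (j, i) = k then 1 else 0) / D.zAt z j i) =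
      if D.side (j, i) = k then 1 else 0 := by
    intro i
    split_ifs with h
    · have : D.zAt z j i = z k := by rw [zAt, h]
      rw [this, mul_one_div_cancel (hz.1 k)]
    · simp
  by_cases hj : j ∈ G
  · have hl : ∀ i, HasDerivAt
        (fun t => b.logw j i (D.wAt w j i) * b.logz j i (D.zAt (Function.update z k t) j i))
        (b.logw j i (D.wAt w j i) * ((D.zAt z j i)⁻¹ * (if D.side (j, i) = k then 1 else 0)))
        (z k) := by
      intro i
      refine HasDerivAt.const_mul _ (HasDerivAt.comp (z k) ?_ (hA i))
      rw [hself]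
      exact (b.logz_branch j hj i).hasDerivAt
    have hder := ((((hl 0).neg.add (hl 1)).sub (hl 2)).add (hl 3)).congr_of_eventuallyEq
      (f₁ := fun t => b.term j (Function.update z k t) w)
      (Filter.EventuallyEq.of_eq (funext fun t => if_pos hj))
    refine ⟨![-b.logw j 0 (D.wAt w j 0), b.logw j 1 (D.wAt w j 1), -b.logw j 2 (D.wAt w j 2),
      b.logw j 3 (D.wAt w j 3)], _, ?_, hder, ?_⟩
    rotate_left
    · simp only [Fin.sum_univ_four, Matrix.cons_val]
      linear_combination -b.logw j 0 (D.wAt w j 0) * hr 0 + b.logw j 1 (D.wAt w j 1) * hr 1 -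
        b.logw j 2 (D.wAt w j 2) * hr 2 + b.logw j 3 (D.wAt w j 3) * hr 3
    · have hw := fun i => (b.logw_branch j hj i).exp_eq
      intro i
      fin_cases i <;> simp [sideFactor, hj, Complex.exp_neg, hw]
  · have hli : ∀ n (i i' : Fin 4), IsDilogBranch (b.li j n) (D.zAt z j i / D.zAt z j i') →
        ∃ m, Complex.exp m = 1 - D.zAt z j i / D.zAt z j i' ∧
        HasDerivAt (fun t => b.li j n (D.zAt (Function.update z k t) j i /
          D.zAt (Function.update z k t) j i'))
          (-m * ((if D.side (j, i) = k then 1 else 0) / D.zAt z j i -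
            (if D.side (j, i') = k then 1 else 0) / D.zAt z j i')) (z k) := by
      intro n i i' h
      have := IsDilogBranch.hasDerivAt_div (L := b.li j n) (by simpa only [hself] using h)
        (hA i) (hA i') (by rw [hself]; exact hne i) (by rw [hself]; exact hne i')
      simpa only [hself] using this
    obtain ⟨m0, x0, d0⟩ := hli 0 1 0 (b.li_branch j hj 0)
    obtain ⟨m1, x1, d1⟩ := hli 1 1 2 (b.li_branch j hj 1)
    obtain ⟨m2, x2, d2⟩ := hli 2 3 2 (b.li_branch j hj 2)
    obtain ⟨m3, x3, d3⟩ := hli 3 3 0 (b.li_branch j hj 3)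
    have hder := (((d0.sub d1).add d2).sub d3).congr_of_eventuallyEq
      (f₁ := fun t => b.term j (Function.update z k t) w)
      (Filter.EventuallyEq.of_eq (funext fun t => if_neg hj))
    refine ⟨![m0 - m3, m1 - m0, m2 - m1, m3 - m2], _, ?_, hder, ?_⟩
    rotate_left
    · simp only [Fin.sum_univ_four, Matrix.cons_val]
      linear_combination (m0 - m3) * hr 0 + (m1 - m0) * hr 1 + (m2 - m1) * hr 2 +
        (m3 - m2) * hr 3
    · intro i
      fin_cases i <;> simp [sideFactor, hj, Complex.exp_sub, x0, x1, x2, x3]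

/-- The equations of the side variables say that the factors at both ends of every side are inverse
to each other. -/
theorem Branches.zEquations_iff (b : D.Branches G z w) (hz : D.Admissible G z w) :
    D.ZEquations b.V z w ↔ ∀ δ, sideFactor G z w δ * sideFactor G z w (D.across δ) = 1 := by
  have key : ∀ k : D.Side,
      Complex.exp (z k * deriv (fun t : ℂ => b.V (Function.update z k t) w) (z k)) =
        sideFactor G z w k.1 * sideFactor G z w (D.across k.1) := by
    intro k
    choose c d hc hd hs using b.hasDerivAt_term_z hz k
    have hV : HasDerivAt (fun t : ℂ => b.V (Function.update z k t) w) (∑ j, d j) (z k) := by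
      simp only [Branches.V_eq_sum]
      exact HasDerivAt.fun_sum fun j _ => hd j
    rw [hV.deriv, Finset.mul_sum]
    simp only [hs, Complex.exp_sum]
    have h1 : ∀ δ : D.Dart, Complex.exp (c δ.1 δ.2 * if D.side δ = k then 1 else 0) =
        if δ ∈ ({k.1, D.across k.1} : Finset D.Dart) then sideFactor G z w δ else 1 := by
      intro δ
      simp only [side_eq_iff, Finset.mem_insert, Finset.mem_singleton]
      split_ifs
      · rw [mul_one]; exact hc _ _
      · rw [mul_zero, Complex.exp_zero]
    have h2 := Fintype.prod_prod_type
      (fun δ : D.Dart => Complex.exp (c δ.1 δ.2 * if D.side δ = k then 1 else 0))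
    rw [← h2]
    simp only [h1, Finset.prod_ite_mem, Finset.univ_inter]
    rw [Finset.prod_pair (across_ne _).symm]
  constructor
  · intro h δ
    rcases (side_eq_iff (D.side δ) δ).1 rfl with e | e
    · rw [e, ← key]
      exact h _
    · rw [e, D.across_across, mul_comm, ← key]
      exact h _
  · intro h k
    rw [key]
    exact h _

end LinkDiagram

/-! ### The equations of the variables at degenerate crossings -/

namespace LinkDiagram

variable {D : LinkDiagram}

/-- The exponent of the `n`-th variable in the values `w_e, w_f, w_g, w_e w_g / w_f` at the ends
`0, 1, 2, 3` of a crossing where `w_e, w_f, w_g` are the variables with the indices `a, 1, c`. -/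
def wExponent (a c n : Fin 3) : Fin 4 → ℂ :=
  let α : ℂ := if a = n then 1 else 0
  let β : ℂ := if 1 = n then 1 else 0
  let γ : ℂ := if c = n then 1 else 0
  ![α, β, γ, α + γ - β]

variable {G : Set D.Crossing} {z : D.Side → ℂ} {w : D.Crossing → Fin 3 → ℂ}

/-- The indices of the variables `w` used at the ends `0` and `2` of a crossing; both ends of the loop
of a kink use the variable with index `1`. -/
def wIndices (D : LinkDiagram) (j : D.Crossing) : Fin 3 × Fin 3 :=
  (if D.across (j, 0) = (j, 1) ∨ D.across (j, 2) = (j, 3) then 1 else 0,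
   if D.across (j, 1) = (j, 2) ∨ D.across (j, 3) = (j, 0) then 1 else 2)

theorem wAt_eq_of_index (w' : D.Crossing → Fin 3 → ℂ) (j : D.Crossing) :
    D.wAt w' j = ![w' j (wIndices D j).1, w' j 1, w' j (wIndices D j).2,
      w' j (wIndices D j).1 * w' j (wIndices D j).2 / w' j 1] := by
  unfold wAt wIndices
  split_ifs <;> rfl

theorem hasDerivAt_update (v : Fin 3 → ℂ) (n a : Fin 3) :
    HasDerivAt (fun t => Function.update v n t a) (if a = n then 1 else 0) (v n) := by
  by_cases h : a = n
  · subst h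
    simp only [if_true, Function.update_self]
    exact hasDerivAt_id _
  · simp only [h, if_false, Function.update_of_ne, ne_eq, not_false_eq_true]
    exact hasDerivAt_const _ _

theorem hasDerivAt_wAt {j : D.Crossing} (hw : ∀ i, D.wAt w j i ≠ 0) (n : Fin 3) (i : Fin 4) :
    ∃ d, HasDerivAt (fun t => D.wAt (Function.update w j (Function.update (w j) n t)) j i) d
        (w j n) ∧
      w j n * d = wExponent (wIndices D j).1 (wIndices D j).2 n i * D.wAt w j i := by
  rw [wAt_eq_of_index] at hw ⊢
  simp only [wAt_eq_of_index, Function.update_self]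
  have hu := hasDerivAt_update (w j) n
  have hv : ∀ a, Function.update (w j) n (w j n) a = w j a := fun a => by
    rw [Function.update_eq_self]
  have hm : ∀ a, w j n * (if a = n then 1 else 0) = (if a = n then 1 else 0) * w j a := by
    intro a
    split_ifs with h
    · rw [h]; ring
    · simp
  have w1 : w j 1 ≠ 0 := hw 1
  generalize (wIndices D j).1 = a
  generalize (wIndices D j).2 = c
  have h4 : HasDerivAt (fun t => Function.update (w j) n t a * Function.update (w j) n t c /
      Function.update (w j) n t 1) _ (w j n) :=
    (((hu a).mul (hu c)).div (hu 1) (by rw [hv]; exact w1))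
  simp only [hv] at h4
  fin_cases i
  · exact ⟨_, hu _, hm _⟩
  · exact ⟨_, hu _, hm _⟩
  · exact ⟨_, hu _, hm _⟩
  · refine ⟨_, h4, ?_⟩
    simp only [wExponent, Fin.reduceFinMk, Matrix.cons_val]
    have ha := hm a
    have h1 := hm 1
    have hc := hm c
    generalize (if a = n then (1 : ℂ) else 0) = α at *
    generalize (if 1 = n then (1 : ℂ) else 0) = β at *
    generalize (if c = n then (1 : ℂ) else 0) = γ at *
    simp
    field_simp
    linear_combination w j c * w j 1 * ha + w j a * w j 1 * hc - w j a * w j c * h1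

/-- Each value `w_e, w_f, w_g` contributes a quotient of two side variables to the equation of its
variable, because it occurs in `w_h` too. -/
theorem Branches.wEquations_iff (b : D.Branches G z w) (hz : D.Admissible G z w) :
    D.WEquations G b.V z w ↔ ∀ j ∈ G, ∀ n : Fin 3,
      (if (wIndices D j).1 = n then D.zAt z j 3 / D.zAt z j 0 else 1) *
        (if 1 = n then D.zAt z j 1 / D.zAt z j 3 else 1) *
        (if (wIndices D j).2 = n then D.zAt z j 3 / D.zAt z j 2 else 1) = 1 := by
  unfold WEquations
  refine forall_congr' fun j => forall_congr' fun hj => forall_congr' fun n => ?_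
  choose d hd hs using hasDerivAt_wAt (hz.2.2 j hj) n
  have hself : ∀ i, D.wAt (Function.update w j (Function.update (w j) n (w j n))) j i =
      D.wAt w j i := by
    intro i; rw [Function.update_eq_self, Function.update_eq_self]
  have hl : ∀ i, HasDerivAt
      (fun t => b.logw j i (D.wAt (Function.update w j (Function.update (w j) n t)) j i) *
        b.logz j i (D.zAt z j i))
      ((D.wAt w j i)⁻¹ * d i * b.logz j i (D.zAt z j i)) (w j n) := by
    intro i
    refine HasDerivAt.mul_const (HasDerivAt.comp (w j n) ?_ (hd i)) _
    rw [hself]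
    exact (b.logw_branch j hj i).hasDerivAt
  obtain ⟨δ, hδ⟩ : ∃ δ, δ = -((D.wAt w j 0)⁻¹ * d 0 * b.logz j 0 (D.zAt z j 0)) +
      (D.wAt w j 1)⁻¹ * d 1 * b.logz j 1 (D.zAt z j 1) -
      (D.wAt w j 2)⁻¹ * d 2 * b.logz j 2 (D.zAt z j 2) +
      (D.wAt w j 3)⁻¹ * d 3 * b.logz j 3 (D.zAt z j 3) := ⟨_, rfl⟩
  have hterm : HasDerivAt
      (fun t => b.term j z (Function.update w j (Function.update (w j) n t))) δ (w j n) := by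
    rw [hδ]
    exact ((((hl 0).neg.add (hl 1)).sub (hl 2)).add (hl 3)).congr_of_eventuallyEq
      (Filter.EventuallyEq.of_eq (funext fun t => if_pos hj))
  have hV : HasDerivAt
      (fun t => b.V z (Function.update w j (Function.update (w j) n t)))
      (∑ k, if k = j then δ else 0) (w j n) := by
    simp only [Branches.V_eq_sum]
    refine HasDerivAt.fun_sum fun k _ => ?_
    split_ifs with hk
    · rw [hk]
      exact hterm
    · have : ∀ t, D.wAt (Function.update w j (Function.update (w j) n t)) k = D.wAt w k := by
        intro t
        rw [wAt_eq_of_index, wAt_eq_of_index, Function.update_of_ne hk]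
      simp only [Branches.term, this]
      exact hasDerivAt_const _ _
  have hsum : w j n * δ = (b.logz j 3 (D.zAt z j 3) - b.logz j 0 (D.zAt z j 0)) *
        (if (wIndices D j).1 = n then 1 else 0) +
      (b.logz j 1 (D.zAt z j 1) - b.logz j 3 (D.zAt z j 3)) * (if 1 = n then 1 else 0) +
      (b.logz j 3 (D.zAt z j 3) - b.logz j 2 (D.zAt z j 2)) *
        (if (wIndices D j).2 = n then 1 else 0) := by
    have hi : ∀ i, w j n * ((D.wAt w j i)⁻¹ * d i * b.logz j i (D.zAt z j i)) =
        wExponent (wIndices D j).1 (wIndices D j).2 n i * b.logz j i (D.zAt z j i) := by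
      intro i
      have h0 := hz.2.2 j hj i
      rw [← mul_assoc, mul_left_comm, hs i]
      field_simp
    have h0 := hi 0
    have h1 := hi 1
    have h2 := hi 2
    have h3 := hi 3
    simp only [wExponent, Matrix.cons_val] at h0 h1 h2 h3
    rw [hδ]
    linear_combination -h0 + h1 - h2 + h3
  have hexp : ∀ (p : Prop) [Decidable p] (y : ℂ),
      Complex.exp (y * if p then 1 else 0) = if p then Complex.exp y else 1 := by
    intro p _ y
    split_ifs <;> simp
  have hlz := fun i => (b.logz_branch j hj i).exp_eq
  rw [hV.deriv, Finset.sum_ite_eq' Finset.univ j, if_pos (Finset.mem_univ j), hsum,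
    Complex.exp_add, Complex.exp_add]
  simp only [hexp, Complex.exp_sub, hlz]

/-- A loop joins neighboring ends of a crossing: a loop joining opposite ends would be a component
passing only over or only under. -/
theorem across_same_crossing (hD : D.EveryComponentOverAndUnder) {j : D.Crossing} {i : Fin 4}
    (h : D.IsLoop (j, i)) : D.across (j, i) = (j, i + 1) ∨ D.across (j, i) = (j, i + 3) := by
  obtain ⟨i', hi'⟩ : ∃ i', D.across (j, i) = (j, i') := ⟨(D.across (j, i)).2, Prod.ext h rfl⟩
  have n0 : i' ≠ i := by
    rintro rfl
    exact across_ne _ hi'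
  have n2 : i' ≠ i + 2 := by
    rintro rfl
    have hs : D.straight (j, i) = (j, i) := by
      rw [straight, hi']
      exact Prod.ext rfl ((by decide : ∀ i : Fin 4, i + 2 + 2 = i) i)
    have hit : ∀ n, D.straight^[n] (j, i) = (j, i) := fun n => Function.iterate_fixed hs n
    obtain ⟨⟨n, hn⟩, m, hm⟩ := hD (j, i)
    rw [hit] at hn hm
    simp only at hn hm
    revert hn hm
    clear hi' hs h n0 hit
    rcases (by decide : ∀ i : Fin 4, i = 0 ∨ i = 1 ∨ i = 2 ∨ i = 3) i with
      rfl | rfl | rfl | rfl <;> simp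
  rw [hi']
  simp only [Prod.mk.injEq, true_and]
  clear hi' h
  revert i i'; decide

theorem zAt_eq_of_across {j j' : D.Crossing} {i i' : Fin 4} (h : D.across (j, i) = (j', i')) :
    D.zAt z j' i' = D.zAt z j i := by
  rw [zAt, zAt, ← h, side_across]

/-- If the ends `i` and `i + 1` of a crossing are joined by a loop, the side variables of the other
sides at the crossing coincide if and only if those of the two remaining ends do. -/
theorem equalAround_of_loop (hD : D.EveryComponentOverAndUnder) {j : D.Crossing} {i : Fin 4}
    (h : D.across (j, i) = (j, i + 1)) :
    (∀ k k' : Fin 4, ¬ D.IsLoop (j, k) → ¬ D.IsLoop (j, k') → D.zAt z j k = D.zAt z j k') ↔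
      D.zAt z j (i + 2) = D.zAt z j (i + 3) := by
  have h' : D.across (j, i + 1) = (j, i) := by rw [← h, D.across_across]
  have hl : D.IsLoop (j, i) := by rw [IsLoop, h]
  have hl' : D.IsLoop (j, i + 1) := by rw [IsLoop, h']
  have e1 : i + 2 + 1 = i + 3 := (by decide : ∀ i : Fin 4, i + 2 + 1 = i + 3) i
  have e2 : i + 2 + 3 = i + 1 := (by decide : ∀ i : Fin 4, i + 2 + 3 = i + 1) i
  have e3 : i + 3 + 1 = i := (by decide : ∀ i : Fin 4, i + 3 + 1 = i) i
  have e4 : i + 3 + 3 = i + 2 := (by decide : ∀ i : Fin 4, i + 3 + 3 = i + 2) i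
  have e5 : i + 2 ≠ i := (by decide : ∀ i : Fin 4, i + 2 ≠ i) i
  have e6 : i + 3 ≠ i + 1 := (by decide : ∀ i : Fin 4, i + 3 ≠ i + 1) i
  constructor
  · intro H
    by_cases l2 : D.IsLoop (j, i + 2)
    · rcases across_same_crossing hD l2 with e | e
      · rw [e1] at e
        exact (zAt_eq_of_across e).symm
      · rw [e2] at e
        have := congrArg D.across e
        rw [D.across_across, h'] at this
        exact absurd (congrArg Prod.snd this) e5
    · by_cases l3 : D.IsLoop (j, i + 3)
      · rcases across_same_crossing hD l3 with e | e
        · rw [e3] at e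
          have := congrArg D.across e
          rw [D.across_across, h] at this
          exact absurd (congrArg Prod.snd this) e6
        · rw [e4] at e
          exact zAt_eq_of_across e
      · exact H _ _ l2 l3
  · intro H
    have hk : ∀ k : Fin 4, ¬ D.IsLoop (j, k) → D.zAt z j k = D.zAt z j (i + 2) := by
      intro k hk
      rcases (by decide : ∀ i k : Fin 4, k = i ∨ k = i + 1 ∨ k = i + 2 ∨ k = i + 3) i k with
        rfl | rfl | rfl | rfl
      · exact absurd hl hk
      · exact absurd hl' hk
      · rfl
      · exact H.symm
    intro k k' l l'
    rw [hk k l, hk k' l']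

theorem Branches.wEquations_iff_equalAroundDegenerate (hD : D.EveryComponentOverAndUnder)
    (b : D.Branches G z w) (hz : D.Admissible G z w) :
    D.WEquations G b.V z w ↔ D.EqualAroundDegenerate G z := by
  rw [b.wEquations_iff hz]
  refine forall_congr' fun j => forall_congr' fun hj => ?_
  have hne : ∀ i, D.zAt z j i ≠ 0 := fun i => hz.1 _
  -- a loop at the ends `0, 1` or `2, 3`, at `1, 2` or `3, 0`, and no loop
  have key01 : ∀ y : Fin 4 → ℂ, (∀ i, y i ≠ 0) → ((∀ n : Fin 3,
      (if 1 = n then y 3 / y 0 else 1) * (if 1 = n then y 1 / y 3 else 1) *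
        (if 2 = n then y 3 / y 2 else 1) = 1) ↔ y 0 = y 1 ∧ y 2 = y 3) := by
    intro y hy
    have h0 := hy 0
    have h2 := hy 2
    have h3 := hy 3
    simp only [Fin.forall_fin_succ]
    simp [div_mul_div_cancel₀' h3, div_eq_one_iff_eq, h0, h2]
    rw [eq_comm, @eq_comm _ (y 3)]
  have key12 : ∀ y : Fin 4 → ℂ, (∀ i, y i ≠ 0) → ((∀ n : Fin 3,
      (if 0 = n then y 3 / y 0 else 1) * (if 1 = n then y 1 / y 3 else 1) *
        (if 1 = n then y 3 / y 2 else 1) = 1) ↔ y 0 = y 3 ∧ y 1 = y 2) := by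
    intro y hy
    have h0 := hy 0
    have h2 := hy 2
    have h3 := hy 3
    simp only [Fin.forall_fin_succ]
    simp [div_mul_div_cancel₀ h3, div_eq_one_iff_eq, h0, h2]
    exact fun _ => eq_comm
  have key : ∀ y : Fin 4 → ℂ, (∀ i, y i ≠ 0) → ((∀ n : Fin 3,
      (if 0 = n then y 3 / y 0 else 1) * (if 1 = n then y 1 / y 3 else 1) *
        (if 2 = n then y 3 / y 2 else 1) = 1) ↔ y 3 = y 0 ∧ y 1 = y 3 ∧ y 3 = y 2) := by
    intro y hy
    have h0 := hy 0
    have h2 := hy 2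
    have h3 := hy 3
    simp only [Fin.forall_fin_succ]
    simp [div_eq_one_iff_eq, h0, h2, h3]
  by_cases c01 : D.across (j, 0) = (j, 1) ∨ D.across (j, 2) = (j, 3)
  · have c12 : ¬ (D.across (j, 1) = (j, 2) ∨ D.across (j, 3) = (j, 0)) := by
      rintro (e | e) <;> rcases c01 with f | f
      all_goals
        have e' := congrArg D.across e
        have f' := congrArg D.across f
        rw [D.across_across] at e' f'
        simp [e, f] at e' f'
    simp only [wIndices, c01, c12, if_true, if_false]
    rw [key01 (D.zAt z j) hne]
    rcases c01 with c | c
    · rw [equalAround_of_loop hD (i := 0) c]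
      exact and_iff_right (zAt_eq_of_across c).symm
    · rw [equalAround_of_loop hD (i := 2) c]
      exact and_iff_left (zAt_eq_of_across c).symm
  · by_cases c12 : D.across (j, 1) = (j, 2) ∨ D.across (j, 3) = (j, 0)
    · simp only [wIndices, c01, c12, if_true, if_false]
      rw [key12 (D.zAt z j) hne]
      rcases c12 with c | c
      · rw [equalAround_of_loop hD (i := 1) c, and_iff_left (zAt_eq_of_across c).symm]
        exact eq_comm
      · rw [equalAround_of_loop hD (i := 3) c]
        exact and_iff_right (zAt_eq_of_across c)
    · simp only [wIndices, c01, c12, if_false]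
      rw [key (D.zAt z j) hne]
      have hno : ∀ i, D.across (j, i) ≠ (j, i + 1) := by
        intro i e
        fin_cases i
        · exact c01 (Or.inl e)
        · exact c12 (Or.inl e)
        · exact c01 (Or.inr e)
        · exact c12 (Or.inr e)
      have hnl : ∀ i, ¬ D.IsLoop (j, i) := by
        intro i hl
        rcases across_same_crossing hD hl with e | e
        · exact hno i e
        · refine hno (i + 3) ?_
          rw [← e, D.across_across, (by decide : ∀ i : Fin 4, i + 3 + 1 = i) i]
      constructor
      · rintro ⟨e0, e1, e2⟩
        have : ∀ i, D.zAt z j i = D.zAt z j 3 := by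
          intro i
          fin_cases i
          · exact e0.symm
          · exact e1
          · exact e2.symm
          · rfl
        intro i i' _ _
        rw [this i, this i']
      · intro H
        exact ⟨H _ _ (hnl _) (hnl _), H _ _ (hnl _) (hnl _), H _ _ (hnl _) (hnl _)⟩

end LinkDiagram

/-! ### Branches and the equivalence -/

/-- Every logarithm of `u` is the value of a branch. -/
theorem exists_isLogBranch_of_value {c u : ℂ} (hu : u ≠ 0) (hc : Complex.exp c = u) :
    ∃ ℓ : ℂ → ℂ, IsLogBranch ℓ u ∧ ℓ u = c := by
  refine ⟨fun x => c + Complex.log (x / u), ?_, by simp [hu]⟩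
  have hslit : ∀ᶠ x in nhds u, x / u ∈ Complex.slitPlane := by
    refine ContinuousAt.eventually_mem (f := fun x : ℂ => x / u) (by fun_prop) ?_
    rw [div_self hu]
    exact Complex.isOpen_slitPlane.mem_nhds Complex.one_mem_slitPlane
  filter_upwards [hslit] with x hx
  refine ⟨DifferentiableAt.const_add _ ((differentiableAt_id.div_const u).clog hx), ?_⟩
  rw [Complex.exp_add, hc, Complex.exp_log (Complex.slitPlane_ne_zero hx), mul_div_cancel₀ _ hu]

/-- Any point of `ℂ ∖ {0, 1}` is reached by the path `1 - exp (t log (1 - u))`, along which the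
logarithm of `1 - γ` is evident. -/
theorem exists_isDilogBranch {u : ℂ} (h0 : u ≠ 0) (h1 : u ≠ 1) : ∃ L, IsDilogBranch L u := by
  have h1' : 1 - u ≠ 0 := sub_ne_zero.2 h1.symm
  set c := Complex.log (1 - u) with hc
  have hexp : Complex.exp c = 1 - u := Complex.exp_log h1'
  have hc0 : c ≠ 0 := by
    intro h
    rw [h, Complex.exp_zero] at hexp
    exact h0 (by linear_combination hexp)
  obtain ⟨ℓ, hℓ, hℓc⟩ := exists_isLogBranch_of_value h1' hexp
  set m : ℂ → ℂ := fun x => ℓ (1 - x) with hm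
  have hmb : ∀ᶠ x in nhds u, DifferentiableAt ℂ m x ∧ Complex.exp (m x) = 1 - x := by
    have ht : Filter.Tendsto (fun x : ℂ => 1 - x) (nhds u) (nhds (1 - u)) :=
      Continuous.tendsto (by fun_prop) u
    filter_upwards [ht.eventually hℓ] with x hx
    exact ⟨hx.1.comp x (by fun_prop), hx.2⟩
  obtain ⟨r, hr, hball⟩ := Metric.eventually_nhds_iff_ball.1
    (hmb.and (eventually_ne_nhds h0))
  have hd : DifferentiableOn ℂ (fun x => -(m x) / x) (Metric.ball u r) := fun x hx =>
    ((hball x hx).1.1.neg.div differentiableAt_id (hball x hx).2).differentiableWithinAt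
  set γ : ℝ → ℂ := fun t => 1 - Complex.exp (t * c) with hγ
  obtain ⟨L, hLu, hL⟩ := hd.isExactOn_ball.with_val_at u
    (-∫ t in (0 : ℝ)..1, (t * c) / γ t * deriv γ t)
  refine ⟨L, γ, fun t => t * c, m, ?_, by simp [hγ], by simp [hγ, hexp], ?_, ?_, by simp, ?_, hmb,
    by simp [hm, hℓc], hLu, ?_⟩
  · have : ContDiff ℝ 1 fun t : ℝ => (t : ℂ) := Complex.ofRealCLM.contDiff
    have h2 : ContDiff ℝ 1 Complex.exp := Complex.contDiff_exp
    exact contDiff_const.sub (h2.comp (this.mul contDiff_const))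
  · intro t ht h
    have h2 : Complex.exp (t * c) = 1 := by linear_combination -h
    obtain ⟨n, hn⟩ := Complex.exp_eq_one_iff.1 h2
    -- the imaginary part of `t c` lies in `(-π, π]`, so it is no nonzero multiple of `2π`
    have him : t * c.im = n * (2 * Real.pi) := by
      have := congrArg Complex.im hn
      simpa using this
    have h3 : -Real.pi < c.im := Complex.neg_pi_lt_log_im _
    have h4 : c.im ≤ Real.pi := Complex.log_im_le_pi _
    have hpi := Real.pi_pos
    have hn0 : n = 0 := by
      have a1 : (n : ℝ) < 1 := by nlinarith [ht.1, ht.2]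
      have a2 : (-1 : ℝ) < n := by nlinarith [ht.1, ht.2]
      have b1 : n < 1 := by exact_mod_cast a1
      have b2 : -1 < n := by exact_mod_cast a2
      omega
    rw [hn0, Int.cast_zero, zero_mul, mul_eq_zero] at hn
    rcases hn with hn | hn
    · exact ht.1.ne' (by exact_mod_cast hn)
    · exact hc0 hn
  · fun_prop
  · intro t _
    simp [hγ]
  · filter_upwards [Metric.ball_mem_nhds u hr] with x hx
    exact hL x hx

namespace LinkDiagram

variable {D : LinkDiagram} {G : Set D.Crossing} {z : D.Side → ℂ} {w : D.Crossing → Fin 3 → ℂ}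

theorem Admissible.nonempty_branches (hz : D.Admissible G z w) : Nonempty (D.Branches G z w) := by
  have hlog : ∀ u : ℂ, u ≠ 0 → ∃ ℓ, IsLogBranch ℓ u := fun u hu =>
    let ⟨ℓ, h, _⟩ := exists_isLogBranch_of_value hu (Complex.exp_log hu)
    ⟨ℓ, h⟩
  have hli : ∀ j i, ∃ L, j ∉ G → IsDilogBranch L (D.dilogArg z j i) := by
    intro j i
    by_cases hj : j ∈ G
    · exact ⟨0, fun h => absurd hj h⟩
    · have hd := hz.2.1 j hj
      have hn : ∀ i, D.zAt z j i ≠ 0 := fun i => hz.1 _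
      have key : ∀ i i' : Fin 4, i ≠ i' → ∃ L, j ∉ G → IsDilogBranch L (D.zAt z j i / D.zAt z j i') :=
        fun i i' h =>
          let ⟨L, hL⟩ := exists_isDilogBranch (div_ne_zero (hn i) (hn i'))
            fun e => hd i i' h ((div_eq_one_iff_eq (hn i')).1 e)
          ⟨L, fun _ => hL⟩
      fin_cases i
      · exact key 1 0 (by decide)
      · exact key 1 2 (by decide)
      · exact key 3 2 (by decide)
      · exact key 3 0 (by decide)
  have hlw : ∀ j i, ∃ ℓ, j ∈ G → IsLogBranch ℓ (D.wAt w j i) := by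
    intro j i
    by_cases hj : j ∈ G
    · obtain ⟨ℓ, h⟩ := hlog _ (hz.2.2 j hj i)
      exact ⟨ℓ, fun _ => h⟩
    · exact ⟨0, fun h => absurd h hj⟩
  choose li hli using hli
  choose lw hlw using hlw
  choose lz hlz using fun j i => hlog (D.zAt z j i) (hz.1 _)
  exact ⟨⟨li, lz, lw, fun j hj i => hli j i hj, fun j _ i => hlz j i, fun j hj i => hlw j i hj⟩⟩

/-- A common value of the side variables of the sides at a crossing that are not loops. -/
def outerValue (z : D.Side → ℂ) (j : D.Crossing) : ℂ :=
  if h : ∃ i : Fin 4, ¬ D.IsLoop (j, i) then D.zAt z j h.choose else 1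

/-- The side variables, changed on loops so that they agree with those of the other sides at the
crossing of the loop. -/
def adjustedValue (z : D.Side → ℂ) (δ : D.Dart) : ℂ :=
  if D.IsLoop δ then outerValue z δ.1 else D.zAt z δ.1 δ.2

theorem adjustedValue_ne_zero (hz : ∀ k, z k ≠ 0) (δ : D.Dart) : adjustedValue z δ ≠ 0 := by
  unfold adjustedValue outerValue zAt
  split_ifs
  · exact hz _
  · exact one_ne_zero
  · exact hz _

theorem adjustedValue_across (δ : D.Dart) : adjustedValue z (D.across δ) = adjustedValue z δ := by
  have h : D.IsLoop (D.across δ) ↔ D.IsLoop δ := by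
    rw [IsLoop, IsLoop, D.across_across]
    exact eq_comm
  unfold adjustedValue
  by_cases hl : D.IsLoop δ
  · rw [if_pos (h.2 hl), if_pos hl, show (D.across δ).1 = δ.1 from hl]
  · rw [if_neg (h.not.2 hl), if_neg hl]
    exact zAt_eq_of_across rfl

theorem adjustedValue_of_notMem (hz : D.Admissible G z w) {j : D.Crossing} (hj : j ∉ G)
    (i : Fin 4) : adjustedValue z (j, i) = D.zAt z j i := by
  refine if_neg fun hl => ?_
  have h : D.across (j, i) = (j, (D.across (j, i)).2) := Prod.ext hl rfl
  refine hz.2.1 j hj (D.across (j, i)).2 i (fun e => across_ne (j, i) ?_) (zAt_eq_of_across h)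
  rw [h, e]

theorem adjustedValue_of_mem (he : D.EqualAroundDegenerate G z) {j : D.Crossing} (hj : j ∈ G)
    (i : Fin 4) : adjustedValue z (j, i) = outerValue z j := by
  unfold adjustedValue
  split_ifs with hl
  · rfl
  · have h : ∃ i : Fin 4, ¬ D.IsLoop (j, i) := ⟨i, hl⟩
    rw [outerValue, dif_pos h]
    exact he j hj _ _ hl h.choose_spec

theorem hyperbolicityEquations_of_sideFactor (hD : D.EveryComponentOverAndUnder)
    {x : D.Crossing × Fin 4 → ℂ} (h : D.IsShapeAssignment G z w x) (hz : D.Admissible G z w)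
    (hφ : ∀ δ, sideFactor G z w δ * sideFactor G z w (D.across δ) = 1)
    (he : D.EqualAroundDegenerate G z) : D.HyperbolicityEquations G x := by
  refine hyperbolicity_of_positions (positions_of_factor hD h hz hφ) h.ne_zero h.ne_one
    (ζ := adjustedValue z) (adjustedValue_ne_zero hz.1) adjustedValue_across ?_ ?_ ?_
  · intro j hj i
    rw [adjustedValue_of_notMem hz hj, adjustedValue_of_notMem hz hj]
    exact h.eq_of_notMem hj i
  · intro j hj i
    rw [adjustedValue_of_mem he hj, adjustedValue_of_mem he hj]
  · intro j hj i
    exact h.inv_of_mem hj i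

/-- Completeness on the closed path around the strand of a side is the equation of this side. -/
theorem sideFactor_of_isComplete {x : D.Crossing × Fin 4 → ℂ} (h : D.IsShapeAssignment G z w x)
    (hc : (D.octahedral (D.subdivision G)).IsComplete x (D.IsLinkVertex (D.subdivision G)))
    (δ : D.Dart) : sideFactor G z w δ * sideFactor G z w (D.across δ) = 1 := by
  rw [← h.turn_eq, ← h.turn_eq]
  exact turn_mul_turn_of_isComplete hc δ

end LinkDiagram

end

theorem proposition1 (D : LinkDiagram) (hD : D.EveryComponentOverAndUnder)
    (ρ : D.LinkGroup →* PSL2C) (a : D.Arc → ParabolicQuandle) (ha : D.IsInducedColoring ρ a)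
    (z : D.Side → ℂ) (w : D.Crossing → Fin 3 → ℂ) (hzw : D.Admissible (D.degenerate a) z w) :
    Nonempty (D.Branches (D.degenerate a) z w) ∧
    ∀ (b : D.Branches (D.degenerate a) z w) (x : D.Crossing × Fin 4 → ℂ),
      D.IsShapeAssignment (D.degenerate a) z w x →
      ((D.ZEquations b.V z w ∧ D.WEquations (D.degenerate a) b.V z w) ↔
        (D.HyperbolicityEquations (D.degenerate a) x ∧
          D.EqualAroundDegenerate (D.degenerate a) z)) := by
  refine ⟨hzw.nonempty_branches, fun b x hx => ?_⟩
  rw [b.zEquations_iff hzw, b.wEquations_iff_equalAroundDegenerate hD hzw]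
  constructor
  · rintro ⟨hφ, he⟩
    exact ⟨LinkDiagram.hyperbolicityEquations_of_sideFactor hD hx hzw hφ he, he⟩
  · rintro ⟨hh, he⟩
    exact ⟨LinkDiagram.sideFactor_of_isComplete hx hh.2, he⟩
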